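/- Let $0\le a_i<b_i$ for $i=1,2,3$, and suppose that $$a_1b_2b_3+b_1a_2a_3\;\le\; b_1a_2b_3+a_1b_2a_3\;\le\; b_1b_2a_3+a_1a_2b_3 .$$ Write points of $\mathbb{R}^4$ as $[f,x_1,x_2,x_3]$. Let $P_2\subset\mathbb{R}^4$ be the double-McCormick relaxation of $f=x_1x_2x_3$ on the box $\prod_i[a_i,b_i]$ that groups $x_1$ and $x_3$ first, i.e. the solution set of the following system, which results from the McCormick inequalities for $w=x_1x_3$ and for $f=wx_2$ by Fourier–Motzkin elimination of $w$: $a_i\le x_i\le b_i$ for $i=1,2,3$, and $$\begin{aligned} f-a_3a_2x_1-a_1a_2x_3-a_1a_3x_2+2a_1a_3a_2&\ge0,\\ f-a_3b_2x_1-a_1b_2x_3-b_1b_3x_2+a_1a_3b_2+b_1b_3b_2&\ge0,\\ f-b_3a_2x_1-b_1a_2x_3-a_1a_3x_2+a_1a_3a_2+b_1b_3a_2&\ge0,\\ f-b_3b_2x_1-b_1b_2x_3-b_1b_3x_2+2b_1b_3b_2&\ge0,\\ -f+b_3b_2x_1+a_1b_2x_3+a_1a_3x_2-a_1a_3b_2-a_1b_3b_2&\ge0,\\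 -f+a_3b_2x_1+b_1b_2x_3+a_1a_3x_2-a_1a_3b_2-b_1a_3b_2&\ge0,\\ -f+b_3a_2x_1+a_1a_2x_3+b_1b_3x_2-a_1b_3a_2-b_1b_3a_2&\ge0,\\ -f+a_3a_2x_1+b_1a_2x_3+b_1b_3x_2-b_1a_3a_2-b_1b_3a_2&\ge0,\\ f-a_1a_3x_2&\ge0,\\ -f+b_1b_3x_2&\ge0. \end{aligned}$$ Let $P_H\subset\mathbb{R}^4$ be the trilinear-hull polytope, i.e. the solution set of $a_i\le x_i\le b_i$ for $i=1,2,3$, and $$\begin{aligned} f-a_2a_3x_1-a_1a_3x_2-a_1a_2x_3+2a_1a_2a_3&\ge0,\\ f-b_2b_3x_1-b_1b_3x_2-b_1b_2x_3+2b_1b_2b_3&\ge0,\\ f-a_2b_3x_1-a_1b_3x_2-b_1a_2x_3+a_1a_2b_3+b_1a_2b_3&\ge0,\\ f-b_2a_3x_1-b_1a_3x_2-a_1b_2x_3+b_1b_2a_3+a_1b_2a_3&\ge0,\\ f-\tfrac{\eta_1}{b_1-a_1}x_1-b_1a_3x_2-b_1a_2x_3+\Big(\tfrac{\eta_1a_1}{b_1-a_1}+b_1b_2a_3+b_1a_2b_3-a_1b_2b_3\Big)&\ge0,\\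 f-\tfrac{\eta_2}{a_1-b_1}x_1-a_1b_3x_2-a_1b_2x_3+\Big(\tfrac{\eta_2b_1}{a_1-b_1}+a_1a_2b_3+a_1b_2a_3-b_1a_2a_3\Big)&\ge0,\\ -f+a_2a_3x_1+b_1a_3x_2+b_1b_2x_3-b_1b_2a_3-b_1a_2a_3&\ge0,\\ -f+b_2a_3x_1+a_1a_3x_2+b_1b_2x_3-b_1b_2a_3-a_1b_2a_3&\ge0,\\ -f+a_2a_3x_1+b_1b_3x_2+b_1a_2x_3-b_1a_2b_3-b_1a_2a_3&\ge0,\\ -f+b_2b_3x_1+a_1a_3x_2+a_1b_2x_3-a_1b_2b_3-a_1b_2a_3&\ge0,\\ -f+a_2b_3x_1+b_1b_3x_2+a_1a_2x_3-b_1a_2b_3-a_1a_2b_3&\ge0,\\ -f+b_2b_3x_1+a_1b_3x_2+a_1a_2x_3-a_1b_2b_3-a_1a_2b_3&\ge0, \end{aligned}$$ where $\eta_1=b_1b_2a_3-a_1b_2b_3-b_1a_2a_3+b_1a_2b_3$ and $\eta_2=a_1a_2b_3-b_1a_2a_3-a_1b_2b_3+a_1b_2a_3$. Let $v^1,\dots,v^8$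 be the eight points $[x_1x_2x_3,x_1,x_2,x_3]$ with $x_i\in\{a_i,b_i\}$ for $i=1,2,3$, put $D=b_1b_3-a_1a_3$, and let $$v_2^9=[\theta^1,b_1,\theta^2,a_3],\quad v_2^{10}=[\theta^3,a_1,\theta^4,b_3],\quad v_2^{11}=[\theta^5,a_1,\theta^6,b_3],\quad v_2^{12}=[\theta^7,b_1,\theta^8,a_3],$$ where $$\begin{aligned} \theta^1&=a_2a_3a_1+\tfrac{a_3(b_1-a_1)(b_2b_3b_1-a_2a_3a_1)}{D},&\theta^2&=a_2+\tfrac{a_3(b_2-a_2)(b_1-a_1)}{D},\\ \theta^3&=a_2a_3a_1+\tfrac{a_1(b_3-a_3)(b_2b_3b_1-a_2a_3a_1)}{D},&\theta^4&=a_2+\tfrac{a_1(b_3-a_3)(b_2-a_2)}{D},\\ \theta^5&=\tfrac{b_3a_1(a_2b_3b_1-a_2a_3b_1-b_2a_3a_1+b_2a_3b_1)}{D},&\theta^6&=a_2+\tfrac{b_3(b_2-a_2)(b_1-a_1)}{D},\\ \theta^7&=\tfrac{a_3b_1(b_2b_3a_1-b_2a_3a_1-a_2b_3a_1+a_2b_3b_1)}{D},&\theta^8&=a_2+\tfrac{b_1(b_3-a_3)(b_2-a_2)}{D}.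 \end{aligned}$$ Then the set of extreme points of $P_2$ is $\{v^1,\dots,v^8\}\cup\{v_2^9,\dots,v_2^{12}\}$. Moreover, the 4-dimensional volumes of $P_2$ and $P_H$ are finite and $$\mathrm{Vol}(P_2)=\mathrm{Vol}(P_H)+\frac{(b_1-a_1)(b_2-a_2)^2(b_3-a_3)^2\big(5(a_1b_1b_3-a_1b_1a_3)+3(b_1^2a_3-a_1^2b_3)\big)}{24(b_1b_3-a_1a_3)}.$$ -/

import Mathlib

open Set MeasureTheory

noncomputable section

/-- The double-McCormick system in the variables `f, xi, xj, xk` for `f = (xi * xj) * xk`, where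
`xi ∈ [ai, bi]` and `xj ∈ [aj, bj]` are grouped first and `xk ∈ [ak, bk]` is the remaining variable:
the McCormick inequalities for `w = xi * xj` and for `f = w * xk`, with `w` eliminated by
Fourier-Motzkin elimination. -/
def DoubleMcCormick (ai bi aj bj ak bk f xi xj xk : ℝ) : Prop :=
  0 ≤ xi - ai ∧
  0 ≤ xj - aj ∧
  0 ≤ f - aj * ak * xi - ai * ak * xj - ai * aj * xk + 2 * ai * aj * ak ∧
  0 ≤ f - aj * bk * xi - ai * bk * xj - bi * bj * xk + ai * aj * bk + bi * bj * bk ∧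
  0 ≤ -xj + bj ∧
  0 ≤ -xi + bi ∧
  0 ≤ f - bj * ak * xi - bi * ak * xj - ai * aj * xk + ai * aj * ak + bi * bj * ak ∧
  0 ≤ f - bj * bk * xi - bi * bk * xj - bi * bj * xk + 2 * bi * bj * bk ∧
  0 ≤ -f + bj * bk * xi + ai * bk * xj + ai * aj * xk - ai * aj * bk - ai * bj * bk ∧
  0 ≤ -f + aj * bk * xi + bi * bk * xj + ai * aj * xk - ai * aj * bk - bi * aj * bk ∧
  0 ≤ -xk + bk ∧
  0 ≤ -f + bj * ak * xi + ai * ak * xj + bi * bj * xk - ai * bj * ak - bi * bj * ak ∧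
  0 ≤ -f + aj * ak * xi + bi * ak * xj + bi * bj * xk - bi * aj * ak - bi * bj * ak ∧
  0 ≤ xk - ak ∧
  0 ≤ f - ai * aj * xk ∧
  0 ≤ -f + bi * bj * xk

/-- The polytope `P₂` in `ℝ⁴`, with coordinates `[f, x₁, x₂, x₃]`: the double-McCormick relaxation
that groups `x₁` and `x₃` first. -/
def polytopeP2 (a₁ b₁ a₂ b₂ a₃ b₃ : ℝ) : Set (Fin 4 → ℝ) :=
  {p | DoubleMcCormick a₁ b₁ a₃ b₃ a₂ b₂ (p 0) (p 1) (p 3) (p 2)}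

/-- The inequality system `H` of the trilinear hull, in the variables `f, x₁, x₂, x₃`. -/
def HullSystem (a₁ b₁ a₂ b₂ a₃ b₃ f x₁ x₂ x₃ : ℝ) : Prop :=
  let η₁ := b₁ * b₂ * a₃ - a₁ * b₂ * b₃ - b₁ * a₂ * a₃ + b₁ * a₂ * b₃
  let η₂ := a₁ * a₂ * b₃ - b₁ * a₂ * a₃ - a₁ * b₂ * b₃ + a₁ * b₂ * a₃
  0 ≤ f - a₂ * a₃ * x₁ - a₁ * a₃ * x₂ - a₁ * a₂ * x₃ + 2 * a₁ * a₂ * a₃ ∧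
  0 ≤ f - b₂ * b₃ * x₁ - b₁ * b₃ * x₂ - b₁ * b₂ * x₃ + 2 * b₁ * b₂ * b₃ ∧
  0 ≤ f - a₂ * b₃ * x₁ - a₁ * b₃ * x₂ - b₁ * a₂ * x₃ + a₁ * a₂ * b₃ + b₁ * a₂ * b₃ ∧
  0 ≤ f - b₂ * a₃ * x₁ - b₁ * a₃ * x₂ - a₁ * b₂ * x₃ + b₁ * b₂ * a₃ + a₁ * b₂ * a₃ ∧
  0 ≤ f - η₁ / (b₁ - a₁) * x₁ - b₁ * a₃ * x₂ - b₁ * a₂ * x₃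
      + (η₁ * a₁ / (b₁ - a₁) + b₁ * b₂ * a₃ + b₁ * a₂ * b₃ - a₁ * b₂ * b₃) ∧
  0 ≤ f - η₂ / (a₁ - b₁) * x₁ - a₁ * b₃ * x₂ - a₁ * b₂ * x₃
      + (η₂ * b₁ / (a₁ - b₁) + a₁ * a₂ * b₃ + a₁ * b₂ * a₃ - b₁ * a₂ * a₃) ∧
  0 ≤ -f + a₂ * a₃ * x₁ + b₁ * a₃ * x₂ + b₁ * b₂ * x₃ - b₁ * b₂ * a₃ - b₁ * a₂ * a₃ ∧
  0 ≤ -f + b₂ * a₃ * x₁ + a₁ * a₃ * x₂ + b₁ * b₂ * x₃ - b₁ * b₂ * a₃ - a₁ * b₂ * a₃ ∧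
  0 ≤ -f + a₂ * a₃ * x₁ + b₁ * b₃ * x₂ + b₁ * a₂ * x₃ - b₁ * a₂ * b₃ - b₁ * a₂ * a₃ ∧
  0 ≤ -f + b₂ * b₃ * x₁ + a₁ * a₃ * x₂ + a₁ * b₂ * x₃ - a₁ * b₂ * b₃ - a₁ * b₂ * a₃ ∧
  0 ≤ -f + a₂ * b₃ * x₁ + b₁ * b₃ * x₂ + a₁ * a₂ * x₃ - b₁ * a₂ * b₃ - a₁ * a₂ * b₃ ∧
  0 ≤ -f + b₂ * b₃ * x₁ + a₁ * b₃ * x₂ + a₁ * a₂ * x₃ - a₁ * b₂ * b₃ - a₁ * a₂ * b₃ ∧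
  0 ≤ x₁ - a₁ ∧
  0 ≤ -x₁ + b₁ ∧
  0 ≤ x₂ - a₂ ∧
  0 ≤ -x₂ + b₂ ∧
  0 ≤ x₃ - a₃ ∧
  0 ≤ -x₃ + b₃

/-- The polytope `P_H` in `ℝ⁴`, with coordinates `[f, x₁, x₂, x₃]`: the feasible set of `H`. -/
def polytopeH (a₁ b₁ a₂ b₂ a₃ b₃ : ℝ) : Set (Fin 4 → ℝ) :=
  {p | HullSystem a₁ b₁ a₂ b₂ a₃ b₃ (p 0) (p 1) (p 2) (p 3)}

/-- The points `v¹, …, v⁸`, listed in this order: all `[x₁x₂x₃, x₁, x₂, x₃]` with every `xᵢ` at one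
of its two bounds. -/
def hullPoints (a₁ b₁ a₂ b₂ a₃ b₃ : ℝ) : Set (Fin 4 → ℝ) :=
  {![b₁ * a₂ * a₃, b₁, a₂, a₃], ![a₁ * a₂ * a₃, a₁, a₂, a₃],
   ![a₁ * a₂ * b₃, a₁, a₂, b₃], ![a₁ * b₂ * a₃, a₁, b₂, a₃],
   ![a₁ * b₂ * b₃, a₁, b₂, b₃], ![b₁ * b₂ * b₃, b₁, b₂, b₃],
   ![b₁ * b₂ * a₃, b₁, b₂, a₃], ![b₁ * a₂ * b₃, b₁, a₂, b₃]}

def theta1 (ai bi aj bj ak bk : ℝ) : ℝ :=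
  ai * aj * ak + aj * (bk - ak) * (bi * bj * bk - ai * aj * ak) / (bj * bk - aj * ak)

def theta2 (ai bi aj bj ak bk : ℝ) : ℝ :=
  ai + aj * (bi - ai) * (bk - ak) / (bj * bk - aj * ak)

def theta3 (ai bi aj bj ak bk : ℝ) : ℝ :=
  ai * aj * ak + ak * (bj - aj) * (bi * bj * bk - ai * aj * ak) / (bj * bk - aj * ak)

def theta4 (ai bi aj bj ak bk : ℝ) : ℝ :=
  ai + ak * (bj - aj) * (bi - ai) / (bj * bk - aj * ak)

def theta5 (ai bi aj bj ak bk : ℝ) : ℝ :=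
  bj * ak * (ai * bj * bk - ai * aj * bk - bi * aj * ak + bi * aj * bk) / (bj * bk - aj * ak)

def theta6 (ai bi aj bj ak bk : ℝ) : ℝ :=
  ai + bj * (bi - ai) * (bk - ak) / (bj * bk - aj * ak)

def theta7 (ai bi aj bj ak bk : ℝ) : ℝ :=
  aj * bk * (bi * bj * ak - bi * aj * ak - ai * bj * ak + ai * bj * bk) / (bj * bk - aj * ak)

def theta8 (ai bi aj bj ak bk : ℝ) : ℝ :=
  ai + bk * (bj - aj) * (bi - ai) / (bj * bk - aj * ak)

/-- The points `v₂⁹, v₂¹⁰, v₂¹¹, v₂¹²`, in this order. The quantities `θ` with lower index `2` are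
the functions above at `i = 2`, `j = i + 1 = 3` and `k = i + 2 = 1` (indices modulo 3). -/
def extraPoints2 (a₁ b₁ a₂ b₂ a₃ b₃ : ℝ) : Set (Fin 4 → ℝ) :=
  {![theta1 a₂ b₂ a₃ b₃ a₁ b₁, b₁, theta2 a₂ b₂ a₃ b₃ a₁ b₁, a₃],
   ![theta3 a₂ b₂ a₃ b₃ a₁ b₁, a₁, theta4 a₂ b₂ a₃ b₃ a₁ b₁, b₃],
   ![theta5 a₂ b₂ a₃ b₃ a₁ b₁, a₁, theta6 a₂ b₂ a₃ b₃ a₁ b₁, b₃],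
   ![theta7 a₂ b₂ a₃ b₃ a₁ b₁, b₁, theta8 a₂ b₂ a₃ b₃ a₁ b₁, a₃]}

end

/-! Rescale the box to the unit cube with coordinates `x, y, z`, and put dᵢ = bᵢ - aᵢ. Then x₁x₂x₃
becomes an affine function plus p·xy + q·xz + r·yz + s·xyz with p = a₃d₁d₂, q = a₂d₁d₃, r = a₁d₂d₃,
s = d₁d₂d₃, and the assumed ordering says r ≤ q ≤ p. Each polytope is the region between two
piecewise affine graphs over the cube, so its volume is an iterated integral.

For P_H, the upper graph replaces every product by a minimum (`le_hullUpper_iff`). The lower graph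
is a combination of positive parts whose coefficients are nonnegative because r is the least of p,
q, r (`hullLower_le_iff`).

For P₂, write x₁x₃ = a₁a₃ + w with w = αx + γz + δxz, α = a₃d₁, γ = a₁d₃, δ = d₁d₃, so that w ranges
over [0, D] with D = α + γ + δ = b₁b₃ - a₁a₃. The McCormick bounds for the product with x₂ increase
with w, so eliminating w means substituting the envelopes of w (`mem_polytopeP2_iff`). Integrating a
positive part of slope D in `y` produces e²/(2D), the source of D in the denominator.

Over a corner of the (x, z)-square w is fixed, and the section of P₂ is a face: a parallelogram,
with vertices at y = 0, w/D, 1, 1 - w/D (`mem_extremePoints_normalizedDouble`). It collapses to a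
segment at the corners where w = 0 and w = D, which leaves 2 + 2 + 4 + 4 = 12 listed points.
Conversely, every convex set containing these points contains P₂
(`normalizedDouble_subset_of_convex`), so P₂ is their convex hull and has no other extreme points.
-/

/-! ### Volumes between graphs by slicing. -/

/-- Tonelli with coordinate `i` split off. The slice is again a set of functions on a `Fin`, so the
formula can be iterated. -/
theorem volume_eq_lintegral_insertNth {n : ℕ} (i : Fin (n + 1)) {S : Set (Fin (n + 1) → ℝ)}
    (hS : MeasurableSet S) :
    volume S = ∫⁻ t : ℝ, volume {q : Fin n → ℝ | i.insertNth (α := fun _ => ℝ) t q ∈ S} := by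
  have h := (volume_preserving_piFinSuccAbove (fun _ : Fin (n + 1) => ℝ) i).symm
  rw [← h.measure_preimage hS.nullMeasurableSet, Measure.volume_eq_prod, Measure.prod_apply]
  · rfl
  · exact (MeasurableEquiv.piFinSuccAbove (fun _ : Fin (n + 1) => ℝ) i).symm.measurable hS

theorem measurableSet_insertNth_slice {n : ℕ} (i : Fin (n + 1)) {S : Set (Fin (n + 1) → ℝ)}
    (hS : MeasurableSet S) (t : ℝ) :
    MeasurableSet {q : Fin n → ℝ | i.insertNth (α := fun _ => ℝ) t q ∈ S} :=
  ((MeasurableEquiv.piFinSuccAbove (fun _ : Fin (n + 1) => ℝ) i).symm.measurable.comp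
    measurable_prodMk_left) hS

theorem lintegral_indicator_Icc_ofReal {a b : ℝ} (hab : a ≤ b) {g : ℝ → ℝ} (hg : Continuous g)
    (h0 : ∀ t ∈ Icc a b, 0 ≤ g t) :
    ∫⁻ t, (Icc a b).indicator (fun t => ENNReal.ofReal (g t)) t
      = ENNReal.ofReal (∫ t in a..b, g t) := by
  rw [lintegral_indicator measurableSet_Icc, intervalIntegral.integral_of_le hab,
    ← integral_Icc_eq_integral_Ioc, ofReal_integral_eq_lintegral_ofReal]
  · exact hg.continuousOn.integrableOn_compact isCompact_Icc
  · exact (ae_restrict_iff' measurableSet_Icc).2 (Filter.Eventually.of_forall h0)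

theorem volume_fin_one_Icc (l u : ℝ) :
    volume {q : Fin 1 → ℝ | l ≤ q 0 ∧ q 0 ≤ u} = ENNReal.ofReal (u - l) := by
  have : {q : Fin 1 → ℝ | l ≤ q 0 ∧ q 0 ≤ u} = Icc (fun _ => l) (fun _ => u) := by
    ext q
    simp [Pi.le_def]
  rw [this, Real.volume_Icc_pi]
  simp

/-- The volume of the region between two continuous graphs over a box, with the graph variable as
coordinate `0`; the integral is iterated with `x₁` outermost and `x₂` innermost. -/
theorem volume_between_graphs {a₁ b₁ a₂ b₂ a₃ b₃ : ℝ} (h₁ : a₁ ≤ b₁) (h₂ : a₂ ≤ b₂) (h₃ : a₃ ≤ b₃)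
    {L U : ℝ → ℝ → ℝ → ℝ} (hL : Continuous fun x : ℝ × ℝ × ℝ => L x.1 x.2.1 x.2.2)
    (hU : Continuous fun x : ℝ × ℝ × ℝ => U x.1 x.2.1 x.2.2)
    (hLU : ∀ x ∈ Icc a₁ b₁, ∀ y ∈ Icc a₂ b₂, ∀ z ∈ Icc a₃ b₃, L x y z ≤ U x y z) :
    volume {p : Fin 4 → ℝ | p 1 ∈ Icc a₁ b₁ ∧ p 2 ∈ Icc a₂ b₂ ∧ p 3 ∈ Icc a₃ b₃ ∧
        L (p 1) (p 2) (p 3) ≤ p 0 ∧ p 0 ≤ U (p 1) (p 2) (p 3)}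
      = ENNReal.ofReal (∫ x in a₁..b₁, ∫ z in a₃..b₃, ∫ y in a₂..b₂, (U x y z - L x y z)) := by
  have hm : MeasurableSet {p : Fin 4 → ℝ | p 1 ∈ Icc a₁ b₁ ∧ p 2 ∈ Icc a₂ b₂ ∧ p 3 ∈ Icc a₃ b₃ ∧
        L (p 1) (p 2) (p 3) ≤ p 0 ∧ p 0 ≤ U (p 1) (p 2) (p 3)} := by
    have hx : Continuous fun p : Fin 4 → ℝ => ((p 1, p 2, p 3) : ℝ × ℝ × ℝ) := by fun_prop
    have c1 : Continuous fun p : Fin 4 → ℝ => L (p 1) (p 2) (p 3) := hL.comp hx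
    have c2 : Continuous fun p : Fin 4 → ℝ => U (p 1) (p 2) (p 3) := hU.comp hx
    refine IsClosed.measurableSet ?_
    refine (isClosed_Icc.preimage (continuous_apply 1)).inter
      ((isClosed_Icc.preimage (continuous_apply 2)).inter
      ((isClosed_Icc.preimage (continuous_apply 3)).inter
      ((isClosed_le c1 (continuous_apply 0)).inter (isClosed_le (continuous_apply 0) c2))))
  have slice₃ : ∀ x y z : ℝ,
      volume {q : Fin 1 → ℝ | x ∈ Icc a₁ b₁ ∧ y ∈ Icc a₂ b₂ ∧ z ∈ Icc a₃ b₃ ∧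
        L x y z ≤ q 0 ∧ q 0 ≤ U x y z}
      = (Icc a₁ b₁).indicator (fun x => (Icc a₃ b₃).indicator (fun z => (Icc a₂ b₂).indicator
          (fun y => ENNReal.ofReal (U x y z - L x y z)) y) z) x := by
    intro x y z
    by_cases hx : x ∈ Icc a₁ b₁ <;> by_cases hy : y ∈ Icc a₂ b₂ <;> by_cases hz : z ∈ Icc a₃ b₃ <;>
      simp only [hx, hy, hz, indicator_of_mem, indicator_of_notMem, true_and, false_and,
        and_false, not_false_eq_true, ofPred_false, measure_empty, volume_fin_one_Icc]
  have hc₂ : Continuous fun x : ℝ × ℝ × ℝ => U x.1 x.2.2 x.2.1 - L x.1 x.2.2 x.2.1 := by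
    have e : Continuous fun x : ℝ × ℝ × ℝ => ((x.1, x.2.2, x.2.1) : ℝ × ℝ × ℝ) := by fun_prop
    exact (hU.comp e).sub (hL.comp e)
  have hc₂' : Continuous fun w : ℝ × ℝ => ∫ y in a₂..b₂, (U w.1 y w.2 - L w.1 y w.2) := by
    refine intervalIntegral.continuous_parametric_intervalIntegral_of_continuous'
      (f := fun (w : ℝ × ℝ) y => U w.1 y w.2 - L w.1 y w.2) ?_ _ _
    have e : Continuous fun x : (ℝ × ℝ) × ℝ => ((x.1.1, x.1.2, x.2) : ℝ × ℝ × ℝ) := by fun_prop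
    exact hc₂.comp e
  have hc₁ : Continuous fun x : ℝ => ∫ z in a₃..b₃, ∫ y in a₂..b₂, (U x y z - L x y z) :=
    intervalIntegral.continuous_parametric_intervalIntegral_of_continuous'
      (f := fun x z => ∫ y in a₂..b₂, (U x y z - L x y z)) hc₂' _ _
  have n₂ : ∀ x ∈ Icc a₁ b₁, ∀ z ∈ Icc a₃ b₃, 0 ≤ ∫ y in a₂..b₂, (U x y z - L x y z) :=
    fun x hx z hz => intervalIntegral.integral_nonneg h₂
      fun y hy => sub_nonneg.2 (hLU x hx y hy z hz)
  have n₁ : ∀ x ∈ Icc a₁ b₁, 0 ≤ ∫ z in a₃..b₃, ∫ y in a₂..b₂, (U x y z - L x y z) :=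
    fun x hx => intervalIntegral.integral_nonneg h₃ (n₂ x hx)
  rw [volume_eq_lintegral_insertNth 1 hm, ← lintegral_indicator_Icc_ofReal h₁ hc₁ n₁]
  refine lintegral_congr fun x => ?_
  have hm₁ := measurableSet_insertNth_slice 1 hm x
  -- Coordinate 1 is gone, so x₃ now has index 2; once it is removed too, x₂ has index 1.
  rw [volume_eq_lintegral_insertNth 2 hm₁]
  have key : ∀ z : ℝ, volume {q : Fin 2 → ℝ | (2 : Fin 3).insertNth (α := fun _ => ℝ) z q ∈
      {q : Fin 3 → ℝ | (1 : Fin 4).insertNth (α := fun _ => ℝ) x q ∈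
      {p : Fin 4 → ℝ | p 1 ∈ Icc a₁ b₁ ∧ p 2 ∈ Icc a₂ b₂ ∧ p 3 ∈ Icc a₃ b₃ ∧
        L (p 1) (p 2) (p 3) ≤ p 0 ∧ p 0 ≤ U (p 1) (p 2) (p 3)}}} =
      (Icc a₁ b₁).indicator (fun x => (Icc a₃ b₃).indicator (fun z =>
        ENNReal.ofReal (∫ y in a₂..b₂, (U x y z - L x y z))) z) x := by
    intro z
    rw [volume_eq_lintegral_insertNth 1 (measurableSet_insertNth_slice 2 hm₁ z)]
    by_cases hx : x ∈ Icc a₁ b₁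
    · by_cases hz : z ∈ Icc a₃ b₃
      · have hcz : Continuous fun y => U x y z - L x y z := by
          have e : Continuous fun y : ℝ => ((x, z, y) : ℝ × ℝ × ℝ) := by fun_prop
          exact hc₂.comp e
        rw [indicator_of_mem hx, indicator_of_mem hz, ← lintegral_indicator_Icc_ofReal h₂ hcz
          fun y hy => sub_nonneg.2 (hLU x hx y hy z hz)]
        refine lintegral_congr fun y => ?_
        refine (slice₃ x y z).trans ?_
        rw [indicator_of_mem hx, indicator_of_mem hz]
      · rw [indicator_of_mem hx, indicator_of_notMem hz, ← lintegral_zero (μ := (volume : Measure ℝ))]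
        refine lintegral_congr fun y => ?_
        refine (slice₃ x y z).trans ?_
        rw [indicator_of_mem hx, indicator_of_notMem hz]
    · rw [indicator_of_notMem hx, ← lintegral_zero (μ := (volume : Measure ℝ))]
      refine lintegral_congr fun y => ?_
      refine (slice₃ x y z).trans ?_
      rw [indicator_of_notMem hx]
  rw [lintegral_congr key]
  by_cases hx : x ∈ Icc a₁ b₁
  · simp only [indicator_of_mem hx]
    exact lintegral_indicator_Icc_ofReal h₃ (hc₂'.comp (by fun_prop : Continuous fun z => (x, z)))
      (n₂ x hx)
  · simp [indicator_of_notMem hx]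

/-- The volume of the region between two continuous graphs over a box, with the graphs given in
coordinates that normalise the box to the unit cube. -/
theorem volume_between_normalized_graphs {a₁ b₁ a₂ b₂ a₃ b₃ : ℝ} (h₁ : a₁ < b₁) (h₂ : a₂ < b₂)
    (h₃ : a₃ < b₃) {L U : ℝ → ℝ → ℝ → ℝ}
    (hL : Continuous fun x : ℝ × ℝ × ℝ => L x.1 x.2.1 x.2.2)
    (hU : Continuous fun x : ℝ × ℝ × ℝ => U x.1 x.2.1 x.2.2)
    (hLU : ∀ x ∈ Icc (0 : ℝ) 1, ∀ y ∈ Icc (0 : ℝ) 1, ∀ z ∈ Icc (0 : ℝ) 1, L x y z ≤ U x y z)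
    {P : Set (Fin 4 → ℝ)}
    (hP : ∀ f x y z : ℝ, ![f, a₁ + (b₁ - a₁) * x, a₂ + (b₂ - a₂) * y, a₃ + (b₃ - a₃) * z] ∈ P ↔
      x ∈ Icc (0 : ℝ) 1 ∧ y ∈ Icc (0 : ℝ) 1 ∧ z ∈ Icc (0 : ℝ) 1 ∧ L x y z ≤ f ∧ f ≤ U x y z) :
    volume P = ENNReal.ofReal ((b₁ - a₁) * (b₂ - a₂) * (b₃ - a₃) *
      ∫ x in (0 : ℝ)..1, ∫ z in (0 : ℝ)..1, ∫ y in (0 : ℝ)..1, (U x y z - L x y z)) := by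
  have icc : ∀ {a b : ℝ}, a < b → ∀ t : ℝ, (t - a) / (b - a) ∈ Icc (0 : ℝ) 1 ↔ t ∈ Icc a b := by
    intro a b hab t
    have : 0 < b - a := sub_pos.2 hab
    rw [mem_Icc, mem_Icc, le_div_iff₀ this, div_le_iff₀ this]
    constructor <;> rintro ⟨h, h'⟩ <;> constructor <;> linarith
  have rep : ∀ {a b : ℝ}, a < b → ∀ t : ℝ, a + (b - a) * ((t - a) / (b - a)) = t := by
    intro a b hab t
    have : b - a ≠ 0 := (sub_pos.2 hab).ne'
    field_simp
    ring
  have subst : ∀ {a b : ℝ}, a < b → ∀ g : ℝ → ℝ,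
      ∫ t in a..b, g ((t - a) / (b - a)) = (b - a) * ∫ t in (0 : ℝ)..1, g t := by
    intro a b hab g
    have : b - a ≠ 0 := (sub_pos.2 hab).ne'
    have e : ∀ t, (t - a) / (b - a) = t / (b - a) - a / (b - a) := fun t => sub_div _ _ _
    simp only [e]
    rw [intervalIntegral.integral_comp_div_sub g this, ← sub_div, ← sub_div, sub_self, zero_div,
      div_self this, smul_eq_mul]
  have hset : P = {p : Fin 4 → ℝ | p 1 ∈ Icc a₁ b₁ ∧ p 2 ∈ Icc a₂ b₂ ∧ p 3 ∈ Icc a₃ b₃ ∧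
      L ((p 1 - a₁) / (b₁ - a₁)) ((p 2 - a₂) / (b₂ - a₂)) ((p 3 - a₃) / (b₃ - a₃)) ≤ p 0 ∧
      p 0 ≤ U ((p 1 - a₁) / (b₁ - a₁)) ((p 2 - a₂) / (b₂ - a₂)) ((p 3 - a₃) / (b₃ - a₃))} := by
    ext p
    have := hP (p 0) ((p 1 - a₁) / (b₁ - a₁)) ((p 2 - a₂) / (b₂ - a₂)) ((p 3 - a₃) / (b₃ - a₃))
    rw [rep h₁, rep h₂, rep h₃, icc h₁, icc h₂, icc h₃] at this
    have hp : ![p 0, p 1, p 2, p 3] = p := by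
      ext i
      fin_cases i <;> rfl
    rw [hp] at this
    exact this
  have e : Continuous fun x : ℝ × ℝ × ℝ => (((x.1 - a₁) / (b₁ - a₁), (x.2.1 - a₂) / (b₂ - a₂),
      (x.2.2 - a₃) / (b₃ - a₃)) : ℝ × ℝ × ℝ) := by fun_prop
  rw [hset, volume_between_graphs h₁.le h₂.le h₃.le
    (L := fun x y z => L ((x - a₁) / (b₁ - a₁)) ((y - a₂) / (b₂ - a₂)) ((z - a₃) / (b₃ - a₃)))
    (U := fun x y z => U ((x - a₁) / (b₁ - a₁)) ((y - a₂) / (b₂ - a₂)) ((z - a₃) / (b₃ - a₃)))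
    (hL.comp e) (hU.comp e) fun x hx y hy z hz =>
      hLU _ ((icc h₁ x).2 hx) _ ((icc h₂ y).2 hy) _ ((icc h₃ z).2 hz)]
  congr 1
  have i₂ : ∀ x z : ℝ, ∫ y in a₂..b₂, (U x ((y - a₂) / (b₂ - a₂)) z - L x ((y - a₂) / (b₂ - a₂)) z)
      = (b₂ - a₂) * ∫ y in (0 : ℝ)..1, (U x y z - L x y z) :=
    fun x z => subst h₂ fun y => U x y z - L x y z
  simp only [i₂]
  rw [subst h₁ fun x => ∫ z in a₃..b₃,
    (b₂ - a₂) * ∫ y in (0 : ℝ)..1, (U x y ((z - a₃) / (b₃ - a₃)) - L x y ((z - a₃) / (b₃ - a₃)))]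
  have i₃ : ∀ x : ℝ, ∫ z in a₃..b₃, (b₂ - a₂) * ∫ y in (0 : ℝ)..1,
      (U x y ((z - a₃) / (b₃ - a₃)) - L x y ((z - a₃) / (b₃ - a₃)))
      = (b₃ - a₃) * ((b₂ - a₂) * ∫ z in (0 : ℝ)..1, ∫ y in (0 : ℝ)..1, (U x y z - L x y z)) := by
    intro x
    rw [intervalIntegral.integral_const_mul,
      subst h₃ fun z => ∫ y in (0 : ℝ)..1, (U x y z - L x y z)]
    ring
  simp only [i₃, intervalIntegral.integral_const_mul]
  ring

/-! ### Piecewise polynomial integrals over the unit interval and the unit square. -/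

theorem integral_cubic (k₀ k₁ k₂ k₃ s t : ℝ) :
    ∫ z in s..t, (k₀ + k₁ * z + k₂ * z ^ 2 + k₃ * z ^ 3)
      = k₀ * (t - s) + k₁ * ((t ^ 2 - s ^ 2) / 2) + k₂ * ((t ^ 3 - s ^ 3) / 3)
        + k₃ * ((t ^ 4 - s ^ 4) / 4) := by
  have i : ∀ f : ℝ → ℝ, Continuous f → IntervalIntegrable f volume s t :=
    fun f hf => hf.intervalIntegrable _ _
  rw [intervalIntegral.integral_add (i _ (by fun_prop)) (i _ (by fun_prop)),
    intervalIntegral.integral_add (i _ (by fun_prop)) (i _ (by fun_prop)),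
    intervalIntegral.integral_add (i _ (by fun_prop)) (i _ (by fun_prop)),
    intervalIntegral.integral_const_mul, intervalIntegral.integral_const_mul,
    intervalIntegral.integral_const_mul, integral_pow, integral_pow, integral_id,
    intervalIntegral.integral_const, smul_eq_mul]
  norm_num
  ring

theorem integral_eq_cubic {g : ℝ → ℝ} {s t : ℝ} (hst : s ≤ t) (k₀ k₁ k₂ k₃ : ℝ)
    (h : ∀ z ∈ Icc s t, g z = k₀ + k₁ * z + k₂ * z ^ 2 + k₃ * z ^ 3) :
    ∫ z in s..t, g z = k₀ * (t - s) + k₁ * ((t ^ 2 - s ^ 2) / 2) + k₂ * ((t ^ 3 - s ^ 3) / 3)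
        + k₃ * ((t ^ 4 - s ^ 4) / 4) := by
  rw [← integral_cubic]
  exact intervalIntegral.integral_congr fun z hz => h z (by rwa [uIcc_of_le hst] at hz)

/-- For e ≥ 0 this is the area of a right triangle with height e and base e/D; the bound e ≤ D keeps
the base inside [0, 1]. -/
theorem integral_posPart_sub_mul {D e : ℝ} (hD : 0 < D) (he : e ≤ D) :
    ∫ y in (0 : ℝ)..1, max (e - D * y) 0 = max e 0 ^ 2 / (2 * D) := by
  rcases le_total e 0 with h | h
  · rw [integral_eq_cubic zero_le_one 0 0 0 0, max_eq_right h]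
    · simp
    · intro y hy
      rw [max_eq_right (by nlinarith [hy.1])]
      ring
  · have h0 : 0 ≤ e / D := div_nonneg h hD.le
    have h1 : e / D ≤ 1 := (div_le_one hD).2 he
    have hc : Continuous fun y : ℝ => max (e - D * y) 0 := by fun_prop
    rw [← intervalIntegral.integral_add_adjacent_intervals (hc.intervalIntegrable 0 (e / D))
      (hc.intervalIntegrable (e / D) 1), integral_eq_cubic h0 e (-D) 0 0,
      integral_eq_cubic h1 0 0 0 0, max_eq_left h]
    · field_simp
      ring
    · intro y hy
      have := (div_le_iff₀ hD).1 hy.1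
      rw [max_eq_right (by linarith)]
      ring
    · intro y hy
      have := (le_div_iff₀ hD).1 hy.2
      rw [max_eq_left (by linarith)]
      ring

theorem integral_posPart_mul_sub_one_add {D e : ℝ} (hD : 0 < D) (he : e ≤ D) :
    ∫ y in (0 : ℝ)..1, max (D * (y - 1) + e) 0 = max e 0 ^ 2 / (2 * D) := by
  have := intervalIntegral.integral_comp_sub_left (a := 0) (b := 1)
    (fun y => max (e - D * y) 0) 1
  rw [sub_self, sub_zero, integral_posPart_sub_mul hD he] at this
  rw [← this]
  congr 1
  ext y
  congr 1
  ring

/-- The quadratic polynomial in two variables with the given coefficients. -/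
def quadPoly (c₀ c₁ c₂ c₃ c₄ c₅ x z : ℝ) : ℝ :=
  c₀ + c₁ * x + c₂ * z + c₃ * x ^ 2 + c₄ * (x * z) + c₅ * z ^ 2

/-- The fractions are the moments of 1, x, z, x², xz, z² on the two triangles cut off by the
diagonal. Splitting the inner integral at z = x leaves a cubic in x. -/
theorem integral_square_of_diagonal {F : ℝ → ℝ → ℝ} (hF : ∀ x, Continuous (F x))
    (c₀ c₁ c₂ c₃ c₄ c₅ k₀ k₁ k₂ k₃ k₄ k₅ : ℝ)
    (hc : ∀ x ∈ Icc (0 : ℝ) 1, ∀ z ∈ Icc (0 : ℝ) 1, z ≤ x →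
      F x z = quadPoly c₀ c₁ c₂ c₃ c₄ c₅ x z)
    (hk : ∀ x ∈ Icc (0 : ℝ) 1, ∀ z ∈ Icc (0 : ℝ) 1, x ≤ z →
      F x z = quadPoly k₀ k₁ k₂ k₃ k₄ k₅ x z) :
    ∫ x in (0 : ℝ)..1, ∫ z in (0 : ℝ)..1, F x z
      = (c₀ / 2 + c₁ / 3 + c₂ / 6 + c₃ / 4 + c₄ / 8 + c₅ / 12)
        + (k₀ / 2 + k₁ / 6 + k₂ / 3 + k₃ / 12 + k₄ / 8 + k₅ / 4) := by
  have inner : ∀ x ∈ Icc (0 : ℝ) 1, ∫ z in (0 : ℝ)..1, F x z =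
      (k₀ + k₂ / 2 + k₅ / 3) + (c₀ - k₀ + k₁ + k₄ / 2) * x
      + (c₁ + c₂ / 2 - k₁ - k₂ / 2 + k₃) * x ^ 2
      + (c₃ + c₄ / 2 + c₅ / 3 - k₃ - k₄ / 2 - k₅ / 3) * x ^ 3 := by
    intro x hx
    rw [← intervalIntegral.integral_add_adjacent_intervals ((hF x).intervalIntegrable 0 x)
      ((hF x).intervalIntegrable x 1),
      integral_eq_cubic hx.1 (c₀ + c₁ * x + c₃ * x ^ 2) (c₂ + c₄ * x) c₅ 0,
      integral_eq_cubic hx.2 (k₀ + k₁ * x + k₃ * x ^ 2) (k₂ + k₄ * x) k₅ 0]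
    · ring
    · intro z hz
      rw [hk x hx z ⟨hx.1.trans hz.1, hz.2⟩ hz.1, quadPoly]
      ring
    · intro z hz
      rw [hc x hx z ⟨hz.1, hz.2.trans hx.2⟩ hz.2, quadPoly]
      ring
  rw [integral_eq_cubic zero_le_one _ _ _ _ inner]
  ring

/-- The reflection z ↦ 1 - z carries the antidiagonal to the diagonal. -/
theorem integral_square_of_antidiagonal {F : ℝ → ℝ → ℝ} (hF : ∀ x, Continuous (F x))
    (c₀ c₁ c₂ c₃ c₄ c₅ k₀ k₁ k₂ k₃ k₄ k₅ : ℝ)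
    (hc : ∀ x ∈ Icc (0 : ℝ) 1, ∀ z ∈ Icc (0 : ℝ) 1, x + z ≤ 1 →
      F x z = quadPoly c₀ c₁ c₂ c₃ c₄ c₅ x z)
    (hk : ∀ x ∈ Icc (0 : ℝ) 1, ∀ z ∈ Icc (0 : ℝ) 1, 1 ≤ x + z →
      F x z = quadPoly k₀ k₁ k₂ k₃ k₄ k₅ x z) :
    ∫ x in (0 : ℝ)..1, ∫ z in (0 : ℝ)..1, F x z
      = (c₀ / 2 + c₁ / 6 + c₂ / 6 + c₃ / 12 + c₄ / 24 + c₅ / 12)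
        + (k₀ / 2 + k₁ / 3 + k₂ / 3 + k₃ / 4 + k₄ * (5 / 24) + k₅ / 4) := by
  have refl : ∀ x, ∫ z in (0 : ℝ)..1, F x z = ∫ z in (0 : ℝ)..1, F x (1 - z) := by
    intro x
    rw [intervalIntegral.integral_comp_sub_left (fun z => F x z) 1, sub_self, sub_zero]
  simp only [refl]
  rw [integral_square_of_diagonal (F := fun x z => F x (1 - z))
    (fun x => (hF x).comp (by fun_prop))
    (k₀ + k₂ + k₅) (k₁ + k₄) (-k₂ - 2 * k₅) k₃ (-k₄) k₅
    (c₀ + c₂ + c₅) (c₁ + c₄) (-c₂ - 2 * c₅) c₃ (-c₄) c₅]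
  · ring
  · intro x hx z hz h
    rw [hk x hx (1 - z) ⟨by linarith [hz.2], by linarith [hz.1]⟩ (by linarith), quadPoly, quadPoly]
    ring
  · intro x hx z hz h
    rw [hc x hx (1 - z) ⟨by linarith [hz.2], by linarith [hz.1]⟩ (by linarith), quadPoly, quadPoly]
    ring

theorem integral_square_sub {F G : ℝ → ℝ → ℝ} (hF : Continuous F.uncurry)
    (hG : Continuous G.uncurry) :
    ∫ x in (0 : ℝ)..1, ∫ z in (0 : ℝ)..1, (F x z - G x z)
      = (∫ x in (0 : ℝ)..1, ∫ z in (0 : ℝ)..1, F x z)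
        - ∫ x in (0 : ℝ)..1, ∫ z in (0 : ℝ)..1, G x z := by
  have c : ∀ {H : ℝ → ℝ → ℝ}, Continuous H.uncurry → ∀ x, Continuous (H x) :=
    fun h x => h.comp (by fun_prop : Continuous fun z => (x, z))
  have inner : ∀ x, ∫ z in (0 : ℝ)..1, (F x z - G x z)
      = (∫ z in (0 : ℝ)..1, F x z) - ∫ z in (0 : ℝ)..1, G x z := fun x =>
    intervalIntegral.integral_sub ((c hF x).intervalIntegrable _ _)
      ((c hG x).intervalIntegrable _ _)
  simp only [inner]
  exact intervalIntegral.integral_sub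
    ((intervalIntegral.continuous_parametric_intervalIntegral_of_continuous' hF 0
      1).intervalIntegrable _ _)
    ((intervalIntegral.continuous_parametric_intervalIntegral_of_continuous' hG 0
      1).intervalIntegrable _ _)

/-! ### The trilinear hull: envelopes and volume. -/

/-- The concave envelope on the unit cube of `p y₁y₂ + q y₁y₃ + r y₂y₃ + s y₁y₂y₃`, for nonnegative
coefficients. -/
def hullUpper (p q r s x y z : ℝ) : ℝ :=
  p * min x y + q * min x z + r * min y z + s * min (min x z) y

/-- The convex envelope on the unit cube of `p y₁y₂ + q y₁y₃ + r y₂y₃ + s y₁y₂y₃`, for nonnegative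
coefficients with `r` the least of `p, q, r`. -/
def hullLower (p q r s x y z : ℝ) : ℝ :=
  r * max (x + y + z - 1) 0 + (q - r) * max (x + z - 1) 0 + (p - r) * max (x + y - 1) 0
    + (r + s) * max (x + y + z - 2) 0

/-- The six inequalities correspond to the six orderings of x, y, z: on each ordering all minima are
coordinates and `hullUpper` equals one of the right-hand sides. Elsewhere that side is larger, since
each minimum is at most either argument. -/
theorem le_hullUpper_iff {p q r s x y z g : ℝ} (hp : 0 ≤ p) (hq : 0 ≤ q) (hr : 0 ≤ r)
    (hs : 0 ≤ s) :
    (g ≤ p * y + (q + r + s) * z ∧ g ≤ p * x + (q + r + s) * z ∧ g ≤ q * z + (p + r + s) * y ∧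
      g ≤ q * x + (p + r + s) * y ∧ g ≤ r * z + (p + q + s) * x ∧ g ≤ r * y + (p + q + s) * x)
      ↔ g ≤ hullUpper p q r s x y z := by
  unfold hullUpper
  constructor
  · rintro ⟨h₁, h₂, h₃, h₄, h₅, h₆⟩
    -- Two of the eight combinations are cyclic and force x = y = z; they are the second alternative
    -- of `first`.
    rcases le_total x y with xy | xy <;> rcases le_total x z with xz | xz <;>
      rcases le_total y z with yz | yz <;> simp only [xy, xz, yz, min_eq_left, min_eq_right] <;>
      first
        | linarith
        | obtain rfl : x = y := by linarith
          obtain rfl : x = z := by linarith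
          linarith
  · intro h
    have hp' := fun t (ht : min x y ≤ t) => mul_le_mul_of_nonneg_left ht hp
    have hq' := fun t (ht : min x z ≤ t) => mul_le_mul_of_nonneg_left ht hq
    have hr' := fun t (ht : min y z ≤ t) => mul_le_mul_of_nonneg_left ht hr
    have hs' := fun t (ht : min (min x z) y ≤ t) => mul_le_mul_of_nonneg_left ht hs
    have px := hp' x (min_le_left _ _)
    have py := hp' y (min_le_right _ _)
    have qx := hq' x (min_le_left _ _)
    have qz := hq' z (min_le_right _ _)
    have ry := hr' y (min_le_left _ _)
    have rz := hr' z (min_le_right _ _)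
    have sx := hs' x ((min_le_left _ _).trans (min_le_left _ _))
    have sz := hs' z ((min_le_left _ _).trans (min_le_right _ _))
    have sy := hs' y (min_le_right _ _)
    refine ⟨?_, ?_, ?_, ?_, ?_, ?_⟩ <;> linarith

/-- The six affine functions are the pieces of `hullLower`: one for x + y + z ≤ 1, one for x + y + z
≥ 2, and four for the signs of x + z - 1 and x + y - 1 in between. Nonnegativity of the coefficients
puts every piece below the sum of positive parts. -/
theorem hullLower_le_iff {p q r s x y z g : ℝ} (hr : 0 ≤ r) (hrq : r ≤ q) (hrp : r ≤ p)
    (hs : 0 ≤ s) (hx : x ∈ Icc (0 : ℝ) 1) (hy : y ∈ Icc (0 : ℝ) 1) (hz : z ∈ Icc (0 : ℝ) 1) :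
    (0 ≤ g ∧ (p + q + s) * x + (p + r + s) * y + (q + r + s) * z - (p + q + r) - 2 * s ≤ g ∧
      q * (x + z - 1) + r * y ≤ g ∧ p * (x + y - 1) + r * z ≤ g ∧
      p * y + q * z + (p + q - r) * (x - 1) ≤ g ∧ r * (x + y + z - 1) ≤ g)
      ↔ hullLower p q r s x y z ≤ g := by
  obtain ⟨hx0, hx1⟩ := hx
  obtain ⟨hy0, hy1⟩ := hy
  obtain ⟨hz0, hz1⟩ := hz
  unfold hullLower
  constructor
  · rintro ⟨h₁, h₂, h₃, h₄, h₅, h₆⟩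
    rcases le_total (x + y + z) 1 with S1 | S1
    · rw [max_eq_right (by linarith), max_eq_right (by linarith), max_eq_right (by linarith),
        max_eq_right (by linarith)]
      linarith
    rw [max_eq_left (a := x + y + z - 1) (by linarith)]
    rcases le_total (x + y + z) 2 with S2 | S2
    · rw [max_eq_right (a := x + y + z - 2) (by linarith)]
      rcases le_total (x + z) 1 with xz | xz <;> rcases le_total (x + y) 1 with xy | xy <;>
        simp only [max_eq_left, max_eq_right, sub_nonneg, sub_nonpos, xz, xy] <;> linarith
    · rw [max_eq_left (by linarith), max_eq_left (by linarith), max_eq_left (by linarith)]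
      linarith
  · intro h
    have hs' : 0 ≤ r + s := by linarith
    have r0 := mul_le_mul_of_nonneg_left (le_max_right (x + y + z - 1) 0) hr
    have r1 := mul_le_mul_of_nonneg_left (le_max_left (x + y + z - 1) 0) hr
    have q0 := mul_le_mul_of_nonneg_left (le_max_right (x + z - 1) 0) (sub_nonneg.2 hrq)
    have q1 := mul_le_mul_of_nonneg_left (le_max_left (x + z - 1) 0) (sub_nonneg.2 hrq)
    have p0 := mul_le_mul_of_nonneg_left (le_max_right (x + y - 1) 0) (sub_nonneg.2 hrp)
    have p1 := mul_le_mul_of_nonneg_left (le_max_left (x + y - 1) 0) (sub_nonneg.2 hrp)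
    have s0 := mul_le_mul_of_nonneg_left (le_max_right (x + y + z - 2) 0) hs'
    have s1 := mul_le_mul_of_nonneg_left (le_max_left (x + y + z - 2) 0) hs'
    refine ⟨?_, ?_, ?_, ?_, ?_, ?_⟩ <;> linarith

/-- Compare the coefficients of p, q, r, s separately. Those of p, q, s are the bounds max(x + z -
1, 0) ≤ min(x, z) and their analogues; that of r is `hyz`, where the negative terms of `hullLower`
move to the right. -/
theorem hullLower_le_hullUpper {p q r s x y z : ℝ} (hr : 0 ≤ r) (hrq : r ≤ q) (hrp : r ≤ p)
    (hs : 0 ≤ s) (hx : x ∈ Icc (0 : ℝ) 1) (hy : y ∈ Icc (0 : ℝ) 1) (hz : z ∈ Icc (0 : ℝ) 1) :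
    hullLower p q r s x y z ≤ hullUpper p q r s x y z := by
  obtain ⟨hx0, hx1⟩ := hx
  obtain ⟨hy0, hy1⟩ := hy
  obtain ⟨hz0, hz1⟩ := hz
  have hxz : max (x + z - 1) 0 ≤ min x z :=
    max_le (le_min (by linarith) (by linarith)) (le_min hx0 hz0)
  have hxy : max (x + y - 1) 0 ≤ min x y :=
    max_le (le_min (by linarith) (by linarith)) (le_min hx0 hy0)
  have hxyz : max (x + y + z - 2) 0 ≤ min (min x z) y :=
    max_le (le_min (le_min (by linarith) (by linarith)) (by linarith))
      (le_min (le_min hx0 hz0) hy0)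
  have hyz : max (x + y + z - 1) 0 + max (x + y + z - 2) 0
      ≤ min y z + max (x + z - 1) 0 + max (x + y - 1) 0 := by
    have m0 := le_min hy0 hz0
    have a0 := le_max_right (x + z - 1) 0
    have a1 := le_max_left (x + z - 1) 0
    have b0 := le_max_right (x + y - 1) 0
    have b1 := le_max_left (x + y - 1) 0
    rcases max_cases (x + y + z - 1) 0 with ⟨h, _⟩ | ⟨h, _⟩ <;>
      rcases max_cases (x + y + z - 2) 0 with ⟨h', _⟩ | ⟨h', _⟩ <;>
      rcases min_cases y z with ⟨h'', _⟩ | ⟨h'', _⟩ <;> linarith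
  have e₁ := mul_le_mul_of_nonneg_left hxz (hr.trans hrq)
  have e₂ := mul_le_mul_of_nonneg_left hxy (hr.trans hrp)
  have e₃ := mul_le_mul_of_nonneg_left hxyz hs
  have e₄ := mul_le_mul_of_nonneg_left hyz hr
  unfold hullLower hullUpper
  linarith

/-- The constants are means over the cube: 1/3 for a minimum of two coordinates, 1/4 for the minimum
of three, and 1/6, 13/24, 1/24 for the positive parts of x + z - 1, x + y + z - 1, x + y + z - 2. -/
theorem integral_hullUpper_sub_hullLower (p q r s : ℝ) :
    ∫ x in (0 : ℝ)..1, ∫ z in (0 : ℝ)..1, ∫ y in (0 : ℝ)..1,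
      (hullUpper p q r s x y z - hullLower p q r s x y z)
      = (p + q + r) / 3 + s / 4 - (4 * p + 4 * q + 6 * r + s) / 24 := by
  have inner : ∀ x ∈ Icc (0 : ℝ) 1, ∀ z ∈ Icc (0 : ℝ) 1, ∫ y in (0 : ℝ)..1,
      (hullUpper p q r s x y z - hullLower p q r s x y z)
      = (p * (x - x ^ 2 / 2) + q * min x z + r * (z - z ^ 2 / 2)
          + s * (min x z - min x z ^ 2 / 2))
        - (r * (x + z - 1 / 2 + max (1 - x - z) 0 ^ 2 / 2) + (q - r) * max (x + z - 1) 0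
          + (p - r) * (x ^ 2 / 2) + (r + s) * (max (x + z - 1) 0 ^ 2 / 2)) := by
    intro x hx z hz
    have hm0 : 0 ≤ min x z := le_min hx.1 hz.1
    have hm1 : min x z ≤ 1 := (min_le_left _ _).trans hx.2
    -- Every kink in `y` is rewritten as a positive part of slope ±1 whose value is at most 1 on [0,
    -- 1], so that the two triangle formulas apply.
    have key : ∀ y, hullUpper p q r s x y z - hullLower p q r s x y z
        = ((p * x + q * min x z + r * z + s * min x z - r * (x + z - 1)
            - (q - r) * max (x + z - 1) 0) + (-r) * y + 0 * y ^ 2 + 0 * y ^ 3)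
          + (-p) * max (x - 1 * y) 0 + (-r) * max (z - 1 * y) 0 + (-s) * max (min x z - 1 * y) 0
          + (-r) * max (1 - x - z - 1 * y) 0 + (-(p - r)) * max (1 * (y - 1) + x) 0
          + (-(r + s)) * max (1 * (y - 1) + (x + z - 1)) 0 := by
      intro y
      have hmin : ∀ m : ℝ, min m y = m - max (m - 1 * y) 0 := by
        intro m
        rcases le_total m y with h | h
        · rw [min_eq_left h, max_eq_right (by linarith)]
          ring
        · rw [min_eq_right h, max_eq_left (by linarith)]
          ring
      have hS : max (x + y + z - 1) 0 = x + y + z - 1 + max (1 - x - z - 1 * y) 0 := by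
        rcases le_total (x + y + z) 1 with h | h
        · rw [max_eq_right (by linarith), max_eq_left (by linarith)]
          ring
        · rw [max_eq_left (by linarith), max_eq_right (by linarith)]
          ring
      have e₁ : 1 * (y - 1) + x = x + y - 1 := by ring
      have e₂ : 1 * (y - 1) + (x + z - 1) = x + y + z - 2 := by ring
      rw [hullUpper, hullLower, hmin x, min_comm y z, hmin z, hmin (min x z), hS, e₁, e₂]
      ring
    simp only [key]
    have i : ∀ f : ℝ → ℝ, Continuous f → IntervalIntegrable f volume 0 1 :=
      fun f hf => hf.intervalIntegrable _ _
    rw [intervalIntegral.integral_add (i _ (by fun_prop)) (i _ (by fun_prop)),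
      intervalIntegral.integral_add (i _ (by fun_prop)) (i _ (by fun_prop)),
      intervalIntegral.integral_add (i _ (by fun_prop)) (i _ (by fun_prop)),
      intervalIntegral.integral_add (i _ (by fun_prop)) (i _ (by fun_prop)),
      intervalIntegral.integral_add (i _ (by fun_prop)) (i _ (by fun_prop)),
      intervalIntegral.integral_add (i _ (by fun_prop)) (i _ (by fun_prop)),
      integral_cubic]
    simp only [intervalIntegral.integral_const_mul]
    rw [integral_posPart_sub_mul one_pos hx.2, integral_posPart_sub_mul one_pos hz.2,
      integral_posPart_sub_mul one_pos hm1,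
      integral_posPart_sub_mul one_pos (by linarith [hx.1, hz.1] : 1 - x - z ≤ 1),
      integral_posPart_mul_sub_one_add one_pos hx.2,
      integral_posPart_mul_sub_one_add one_pos (by linarith [hx.2, hz.2] : x + z - 1 ≤ 1),
      max_eq_left hx.1, max_eq_left hz.1, max_eq_left hm0]
    ring
  have outer : ∫ x in (0 : ℝ)..1, ∫ z in (0 : ℝ)..1, ∫ y in (0 : ℝ)..1,
      (hullUpper p q r s x y z - hullLower p q r s x y z)
      = ∫ x in (0 : ℝ)..1, ∫ z in (0 : ℝ)..1,
        ((p * (x - x ^ 2 / 2) + q * min x z + r * (z - z ^ 2 / 2)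
          + s * (min x z - min x z ^ 2 / 2))
        - (r * (x + z - 1 / 2 + max (1 - x - z) 0 ^ 2 / 2) + (q - r) * max (x + z - 1) 0
          + (p - r) * (x ^ 2 / 2) + (r + s) * (max (x + z - 1) 0 ^ 2 / 2))) := by
    refine intervalIntegral.integral_congr fun x hx => intervalIntegral.integral_congr fun z hz => ?_
    rw [uIcc_of_le zero_le_one] at hx hz
    exact inner x hx z hz
  rw [outer, integral_square_sub
    (F := fun x z => p * (x - x ^ 2 / 2) + q * min x z + r * (z - z ^ 2 / 2)
          + s * (min x z - min x z ^ 2 / 2))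
    (G := fun x z => r * (x + z - 1 / 2 + max (1 - x - z) 0 ^ 2 / 2) + (q - r) * max (x + z - 1) 0
          + (p - r) * (x ^ 2 / 2) + (r + s) * (max (x + z - 1) 0 ^ 2 / 2))
    (by unfold Function.uncurry; fun_prop) (by unfold Function.uncurry; fun_prop),
    integral_square_of_diagonal (fun x => by fun_prop)
      0 p (q + r + s) (-(p / 2)) 0 (-(r / 2) - s / 2)
      0 (p + q + s) r (-(p / 2) - s / 2) 0 (-(r / 2)),
    integral_square_of_antidiagonal (fun x => by fun_prop)
      0 0 0 (r / 2 + (p - r) / 2) r (r / 2)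
      (-(r / 2) - (q - r) + (r + s) / 2) (r + (q - r) - (r + s)) (r + (q - r) - (r + s))
      ((p - r) / 2 + (r + s) / 2) (r + s) ((r + s) / 2)]
  · ring
  · intro x hx z hz h
    rw [max_eq_left (by linarith), max_eq_right (by linarith), quadPoly]
    ring
  · intro x hx z hz h
    rw [max_eq_right (by linarith), max_eq_left (by linarith), quadPoly]
    ring
  · intro x hx z hz h
    rw [min_eq_right h, quadPoly]
    ring
  · intro x hx z hz h
    rw [min_eq_left h, quadPoly]
    ring

/-- After subtraction of the affine part of x₁x₂x₃, the facets of `HullSystem` are the affine pieces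
of the two envelopes. -/
theorem mem_polytopeH_iff {a₁ b₁ a₂ b₂ a₃ b₃ : ℝ}
    (ha₁ : 0 ≤ a₁) (hb₁ : a₁ < b₁) (ha₂ : 0 ≤ a₂) (hb₂ : a₂ < b₂) (ha₃ : 0 ≤ a₃) (hb₃ : a₃ < b₃)
    (hΩ₁ : a₁ * b₂ * b₃ + b₁ * a₂ * a₃ ≤ b₁ * a₂ * b₃ + a₁ * b₂ * a₃)
    (hΩ₂ : b₁ * a₂ * b₃ + a₁ * b₂ * a₃ ≤ b₁ * b₂ * a₃ + a₁ * a₂ * b₃) (f x y z : ℝ) :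
    ![f, a₁ + (b₁ - a₁) * x, a₂ + (b₂ - a₂) * y, a₃ + (b₃ - a₃) * z]
        ∈ polytopeH a₁ b₁ a₂ b₂ a₃ b₃ ↔
      x ∈ Icc (0 : ℝ) 1 ∧ y ∈ Icc (0 : ℝ) 1 ∧ z ∈ Icc (0 : ℝ) 1 ∧
      a₁ * a₂ * a₃ + (b₁ - a₁) * a₂ * a₃ * x + a₁ * (b₂ - a₂) * a₃ * y + a₁ * a₂ * (b₃ - a₃) * z
        + hullLower (a₃ * (b₁ - a₁) * (b₂ - a₂)) (a₂ * (b₁ - a₁) * (b₃ - a₃))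
          (a₁ * (b₂ - a₂) * (b₃ - a₃)) ((b₁ - a₁) * (b₂ - a₂) * (b₃ - a₃)) x y z ≤ f ∧
      f ≤ a₁ * a₂ * a₃ + (b₁ - a₁) * a₂ * a₃ * x + a₁ * (b₂ - a₂) * a₃ * y
          + a₁ * a₂ * (b₃ - a₃) * z
        + hullUpper (a₃ * (b₁ - a₁) * (b₂ - a₂)) (a₂ * (b₁ - a₁) * (b₃ - a₃))
          (a₁ * (b₂ - a₂) * (b₃ - a₃)) ((b₁ - a₁) * (b₂ - a₂) * (b₃ - a₃)) x y z := by
  obtain ⟨d₁, rfl⟩ : ∃ d, b₁ = a₁ + d := ⟨b₁ - a₁, by ring⟩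
  obtain ⟨d₂, rfl⟩ : ∃ d, b₂ = a₂ + d := ⟨b₂ - a₂, by ring⟩
  obtain ⟨d₃, rfl⟩ : ∃ d, b₃ = a₃ + d := ⟨b₃ - a₃, by ring⟩
  simp only [add_sub_cancel_left]
  have h₁ : 0 < d₁ := by linarith
  have h₂ : 0 < d₂ := by linarith
  have h₃ : 0 < d₃ := by linarith
  have hr : 0 ≤ a₁ * d₂ * d₃ := by positivity
  have hq : 0 ≤ a₂ * d₁ * d₃ := by positivity
  have hp : 0 ≤ a₃ * d₁ * d₂ := by positivity
  have hs : 0 ≤ d₁ * d₂ * d₃ := by positivity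
  have hrq : a₁ * d₂ * d₃ ≤ a₂ * d₁ * d₃ := by linarith
  have hrp : a₁ * d₂ * d₃ ≤ a₃ * d₁ * d₂ := by linarith
  have box : ∀ a d t : ℝ, 0 < d → (t ∈ Icc (0 : ℝ) 1 ↔
      0 ≤ a + d * t - a ∧ 0 ≤ -(a + d * t) + (a + d)) := by
    intro a d t hd
    constructor
    · rintro ⟨h0, h1⟩
      constructor <;> nlinarith
    · rintro ⟨h0, h1⟩
      constructor <;> nlinarith
  -- In the two facets with η, the quotient by b₁ - a₁ survives only in a constant that cancels
  -- against the one in the facet.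
  have e₁ : ∀ c, c / d₁ * (a₁ + d₁ * x) = c * a₁ / d₁ + c * x := by
    intro c
    field_simp
  have e₂ : ∀ c, c / (a₁ - (a₁ + d₁)) * (a₁ + d₁ * x)
      = c * (a₁ + d₁) / (a₁ - (a₁ + d₁)) + c * (1 - x) := by
    intro c
    rw [show a₁ - (a₁ + d₁) = -d₁ by ring]
    field_simp
    ring
  change HullSystem _ _ _ _ _ _ f (a₁ + d₁ * x) (a₂ + d₂ * y) (a₃ + d₃ * z) ↔ _
  unfold HullSystem
  simp only [add_sub_cancel_left a₁ d₁, e₁, e₂]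
  constructor
  · rintro ⟨l₁, l₂, l₃, l₄, l₅, l₆, u₁, u₂, u₃, u₄, u₅, u₆, x0, x1, y0, y1, z0, z1⟩
    have hx := (box a₁ d₁ x h₁).2 ⟨by linarith, x1⟩
    have hy := (box a₂ d₂ y h₂).2 ⟨y0, y1⟩
    have hz := (box a₃ d₃ z h₃).2 ⟨z0, z1⟩
    refine ⟨hx, hy, hz,
      le_sub_iff_add_le'.1 ((hullLower_le_iff hr hrq hrp hs hx hy hz).1 ⟨?_, ?_, ?_, ?_, ?_, ?_⟩),
      sub_le_iff_le_add'.1 ((le_hullUpper_iff hp hq hr hs).1 ⟨?_, ?_, ?_, ?_, ?_, ?_⟩)⟩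
    · linarith only [l₁]
    · linarith only [l₂]
    · linarith only [l₃]
    · linarith only [l₄]
    · linarith only [l₅]
    · linarith only [l₆]
    · linarith only [u₁]
    · linarith only [u₂]
    · linarith only [u₃]
    · linarith only [u₅]
    · linarith only [u₄]
    · linarith only [u₆]
  · rintro ⟨hx, hy, hz, hl, hu⟩
    obtain ⟨l₁, l₂, l₃, l₄, l₅, l₆⟩ := (hullLower_le_iff hr hrq hrp hs hx hy hz).2 (le_sub_iff_add_le'.2 hl)
    obtain ⟨u₁, u₂, u₃, u₄, u₅, u₆⟩ := (le_hullUpper_iff hp hq hr hs).2 (sub_le_iff_le_add'.2 hu)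
    obtain ⟨x0, x1⟩ := (box a₁ d₁ x h₁).1 hx
    obtain ⟨y0, y1⟩ := (box a₂ d₂ y h₂).1 hy
    obtain ⟨z0, z1⟩ := (box a₃ d₃ z h₃).1 hz
    refine ⟨?_, ?_, ?_, ?_, ?_, ?_, ?_, ?_, ?_, ?_, ?_, ?_,
      by linarith only [x0], x1, y0, y1, z0, z1⟩
    · linarith only [l₁]
    · linarith only [l₂]
    · linarith only [l₃]
    · linarith only [l₄]
    · linarith only [l₅]
    · linarith only [l₆]
    · linarith only [u₁]
    · linarith only [u₂]
    · linarith only [u₃]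
    · linarith only [u₅]
    · linarith only [u₄]
    · linarith only [u₆]

theorem volume_polytopeH {a₁ b₁ a₂ b₂ a₃ b₃ : ℝ}
    (ha₁ : 0 ≤ a₁) (hb₁ : a₁ < b₁) (ha₂ : 0 ≤ a₂) (hb₂ : a₂ < b₂) (ha₃ : 0 ≤ a₃) (hb₃ : a₃ < b₃)
    (hΩ₁ : a₁ * b₂ * b₃ + b₁ * a₂ * a₃ ≤ b₁ * a₂ * b₃ + a₁ * b₂ * a₃)
    (hΩ₂ : b₁ * a₂ * b₃ + a₁ * b₂ * a₃ ≤ b₁ * b₂ * a₃ + a₁ * a₂ * b₃) :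
    volume (polytopeH a₁ b₁ a₂ b₂ a₃ b₃) = ENNReal.ofReal ((b₁ - a₁) * (b₂ - a₂) * (b₃ - a₃) *
      ((4 * (a₃ * (b₁ - a₁) * (b₂ - a₂)) + 4 * (a₂ * (b₁ - a₁) * (b₃ - a₃))
        + 2 * (a₁ * (b₂ - a₂) * (b₃ - a₃)) + 5 * ((b₁ - a₁) * (b₂ - a₂) * (b₃ - a₃))) / 24)) := by
  have h₁ : 0 < b₁ - a₁ := sub_pos.2 hb₁
  have h₂ : 0 < b₂ - a₂ := sub_pos.2 hb₂
  have h₃ : 0 < b₃ - a₃ := sub_pos.2 hb₃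
  rw [volume_between_normalized_graphs hb₁ hb₂ hb₃ (by unfold hullLower; fun_prop)
    (by unfold hullUpper; fun_prop) ?_
    (mem_polytopeH_iff ha₁ hb₁ ha₂ hb₂ ha₃ hb₃ hΩ₁ hΩ₂)]
  · simp only [add_sub_add_left_eq_sub]
    rw [integral_hullUpper_sub_hullLower]
    congr 1
    ring
  · intro x hx y hy z hz
    have := hullLower_le_hullUpper (p := a₃ * (b₁ - a₁) * (b₂ - a₂))
      (q := a₂ * (b₁ - a₁) * (b₃ - a₃)) (r := a₁ * (b₂ - a₂) * (b₃ - a₃))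
      (s := (b₁ - a₁) * (b₂ - a₂) * (b₃ - a₃)) (by positivity) (by linarith) (by linarith)
      (by positivity) hx hy hz
    linarith only [this]

/-! ### The double-McCormick relaxation: boundary graphs and volume. -/

/-- The lower McCormick envelope, on the unit square, of `α x + γ z + δ x z`. -/
def bilinearLower (α γ δ x z : ℝ) : ℝ := max (α * x + γ * z) (α * x + γ * z + δ * (x + z - 1))

/-- The upper McCormick envelope, on the unit square, of `α x + γ z + δ x z`. -/
def bilinearUpper (α γ δ x z : ℝ) : ℝ := min ((α + δ) * x + γ * z) (α * x + (γ + δ) * z)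

theorem bilinearLower_nonneg {α γ δ x z : ℝ} (hα : 0 ≤ α) (hγ : 0 ≤ γ) (hx : x ∈ Icc (0 : ℝ) 1)
    (hz : z ∈ Icc (0 : ℝ) 1) : 0 ≤ bilinearLower α γ δ x z :=
  le_max_of_le_left (add_nonneg (mul_nonneg hα hx.1) (mul_nonneg hγ hz.1))

theorem bilinearLower_le_bilinearUpper {α γ δ x z : ℝ} (hδ : 0 ≤ δ) (hx : x ∈ Icc (0 : ℝ) 1)
    (hz : z ∈ Icc (0 : ℝ) 1) : bilinearLower α γ δ x z ≤ bilinearUpper α γ δ x z := by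
  have h₁ := mul_nonneg hδ hx.1
  have h₂ := mul_nonneg hδ hz.1
  have h₃ := mul_nonneg hδ (sub_nonneg.2 hx.2)
  have h₄ := mul_nonneg hδ (sub_nonneg.2 hz.2)
  refine max_le (le_min ?_ ?_) (le_min ?_ ?_) <;> linarith

theorem bilinearUpper_le {α γ δ x z : ℝ} (hα : 0 ≤ α) (hγ : 0 ≤ γ) (hδ : 0 ≤ δ)
    (hx : x ∈ Icc (0 : ℝ) 1) (hz : z ∈ Icc (0 : ℝ) 1) :
    bilinearUpper α γ δ x z ≤ α + γ + δ := by
  have h₁ := mul_nonneg (add_nonneg hα hδ) (sub_nonneg.2 hx.2)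
  have h₂ := mul_nonneg hγ (sub_nonneg.2 hz.2)
  exact (min_le_left _ _).trans (by linarith)

/-- The lower boundary of the double-McCormick relaxation, up to an affine function. -/
def doubleLower (a d α γ δ x y z : ℝ) : ℝ :=
  a * bilinearLower α γ δ x z + d * max ((α + γ + δ) * (y - 1) + bilinearLower α γ δ x z) 0

/-- The upper boundary of the double-McCormick relaxation, up to an affine function. -/
def doubleUpper (a d α γ δ x y z : ℝ) : ℝ :=
  (a + d) * bilinearUpper α γ δ x z - d * max (bilinearUpper α γ δ x z - (α + γ + δ) * y) 0

/-- With a, d ≥ 0 the left side increases with the maximum, so each lower bound `s`, `t` of w is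
paired with each lower bound of f: this is the Fourier–Motzkin elimination of w. -/
theorem mul_max_add_mul_posPart_le_iff {a d : ℝ} (ha : 0 ≤ a) (hd : 0 ≤ d) (s t k g : ℝ) :
    a * max s t + d * max (k + max s t) 0 ≤ g ↔
      a * s ≤ g ∧ a * t ≤ g ∧ a * s + d * (k + s) ≤ g ∧ a * t + d * (k + t) ≤ g := by
  constructor
  · intro h
    have h₁ := mul_le_mul_of_nonneg_left (le_max_left s t) ha
    have h₂ := mul_le_mul_of_nonneg_left (le_max_right s t) ha
    have h₃ := mul_le_mul_of_nonneg_left (le_max_left s t) hd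
    have h₄ := mul_le_mul_of_nonneg_left (le_max_right s t) hd
    have h₅ := mul_le_mul_of_nonneg_left (le_max_left (k + max s t) 0) hd
    have h₆ := mul_le_mul_of_nonneg_left (le_max_right (k + max s t) 0) hd
    refine ⟨?_, ?_, ?_, ?_⟩ <;> linarith
  · rintro ⟨h₁, h₂, h₃, h₄⟩
    rcases max_choice s t with e | e <;> rw [e]
    · rcases max_choice (k + s) 0 with e | e <;> rw [e] <;> linarith
    · rcases max_choice (k + t) 0 with e | e <;> rw [e] <;> linarith

theorem le_mul_min_sub_mul_posPart_iff {a d : ℝ} (ha : 0 ≤ a) (hd : 0 ≤ d) (s t k g : ℝ) :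
    g ≤ (a + d) * min s t - d * max (min s t - k) 0 ↔
      g ≤ (a + d) * s ∧ g ≤ (a + d) * t ∧ g ≤ a * s + d * k ∧ g ≤ a * t + d * k := by
  constructor
  · intro h
    have h₁ := mul_le_mul_of_nonneg_left (min_le_left s t) ha
    have h₂ := mul_le_mul_of_nonneg_left (min_le_right s t) ha
    have h₃ := mul_le_mul_of_nonneg_left (min_le_left s t) hd
    have h₄ := mul_le_mul_of_nonneg_left (min_le_right s t) hd
    have h₅ := mul_le_mul_of_nonneg_left (le_max_left (min s t - k) 0) hd
    have h₆ := mul_le_mul_of_nonneg_left (le_max_right (min s t - k) 0) hd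
    refine ⟨?_, ?_, ?_, ?_⟩ <;> linarith
  · rintro ⟨h₁, h₂, h₃, h₄⟩
    rcases min_choice s t with e | e <;> rw [e]
    · rcases max_choice (s - k) 0 with e | e <;> rw [e] <;> linarith
    · rcases max_choice (t - k) 0 with e | e <;> rw [e] <;> linarith

theorem doubleLower_le_doubleUpper {a d α γ δ x y z : ℝ} (ha : 0 ≤ a) (hd : 0 ≤ d) (hα : 0 ≤ α)
    (hγ : 0 ≤ γ) (hδ : 0 ≤ δ) (hx : x ∈ Icc (0 : ℝ) 1) (hy : y ∈ Icc (0 : ℝ) 1)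
    (hz : z ∈ Icc (0 : ℝ) 1) : doubleLower a d α γ δ x y z ≤ doubleUpper a d α γ δ x y z := by
  have h₀ := bilinearLower_nonneg (δ := δ) hα hγ hx hz
  have h₁ := bilinearLower_le_bilinearUpper (α := α) (γ := γ) hδ hx hz
  have h₂ := bilinearUpper_le hα hγ hδ hx hz
  unfold doubleLower doubleUpper
  set e := bilinearLower α γ δ x z
  set u := bilinearUpper α γ δ x z
  have hD : 0 ≤ α + γ + δ := by positivity
  have hy0 := mul_nonneg hD hy.1
  have hy1 := mul_nonneg hD (sub_nonneg.2 hy.2)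
  -- When both positive parts are active the sum is e + u - D, and e ≤ u ≤ D.
  have key : max ((α + γ + δ) * (y - 1) + e) 0 + max (u - (α + γ + δ) * y) 0 ≤ u := by
    rcases max_choice ((α + γ + δ) * (y - 1) + e) 0 with h | h <;>
      rcases max_choice (u - (α + γ + δ) * y) 0 with h' | h' <;> rw [h, h'] <;> linarith
  have k₁ := mul_le_mul_of_nonneg_left key hd
  have k₂ := mul_le_mul_of_nonneg_left h₁ ha
  linarith

/-- Since both envelopes of w lie in [0, D], the `y`-integral turns each positive part into a square
over 2D. What remains is quadratic on each side of the diagonal (upper) or antidiagonal (lower). -/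
theorem integral_doubleUpper_sub_doubleLower {α γ δ : ℝ} (a d : ℝ) (hα : 0 ≤ α) (hγ : 0 ≤ γ)
    (hδ : 0 < δ) :
    ∫ x in (0 : ℝ)..1, ∫ z in (0 : ℝ)..1, ∫ y in (0 : ℝ)..1,
      (doubleUpper a d α γ δ x y z - doubleLower a d α γ δ x y z)
      = (a + d) * (α / 2 + γ / 2 + δ / 3) - a * (α / 2 + γ / 2 + δ / 6)
        - d / (2 * (α + γ + δ)) * (α ^ 2 / 4 + α * (γ + δ) / 4 + (γ + δ) ^ 2 / 12
          + (α + δ) ^ 2 / 12 + (α + δ) * γ / 4 + γ ^ 2 / 4)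
        - d / (2 * (α + γ + δ)) * (α ^ 2 / 12 + α * γ / 12 + γ ^ 2 / 12 + δ ^ 2 / 2
          - 2 * δ * (α + δ) / 3 - 2 * δ * (γ + δ) / 3 + (α + δ) ^ 2 / 4
          + 5 * (α + δ) * (γ + δ) / 12 + (γ + δ) ^ 2 / 4) := by
  have hD : 0 < α + γ + δ := by positivity
  have inner : ∀ x ∈ Icc (0 : ℝ) 1, ∀ z ∈ Icc (0 : ℝ) 1, ∫ y in (0 : ℝ)..1,
      (doubleUpper a d α γ δ x y z - doubleLower a d α γ δ x y z)
      = ((a + d) * bilinearUpper α γ δ x z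
          - d / (2 * (α + γ + δ)) * bilinearUpper α γ δ x z ^ 2)
        - (a * bilinearLower α γ δ x z
          + d / (2 * (α + γ + δ)) * bilinearLower α γ δ x z ^ 2) := by
    intro x hx z hz
    have h₀ := bilinearLower_nonneg (δ := δ) hα hγ hx hz
    have h₁ := bilinearLower_le_bilinearUpper (α := α) (γ := γ) hδ.le hx hz
    have h₂ := bilinearUpper_le hα hγ hδ.le hx hz
    unfold doubleLower doubleUpper
    set e := bilinearLower α γ δ x z
    set u := bilinearUpper α γ δ x z
    have i : ∀ f : ℝ → ℝ, Continuous f → IntervalIntegrable f volume 0 1 :=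
      fun f hf => hf.intervalIntegrable _ _
    rw [intervalIntegral.integral_sub (i _ (by fun_prop)) (i _ (by fun_prop)),
      intervalIntegral.integral_sub (i _ (by fun_prop)) (i _ (by fun_prop)),
      intervalIntegral.integral_add (i _ (by fun_prop)) (i _ (by fun_prop)),
      intervalIntegral.integral_const_mul d, intervalIntegral.integral_const_mul d,
      integral_posPart_sub_mul hD h₂, integral_posPart_mul_sub_one_add hD (h₁.trans h₂),
      max_eq_left h₀, max_eq_left (h₀.trans h₁), intervalIntegral.integral_const,
      intervalIntegral.integral_const]
    simp only [sub_zero, one_smul]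
    ring
  have outer : ∫ x in (0 : ℝ)..1, ∫ z in (0 : ℝ)..1, ∫ y in (0 : ℝ)..1,
      (doubleUpper a d α γ δ x y z - doubleLower a d α γ δ x y z)
      = ∫ x in (0 : ℝ)..1, ∫ z in (0 : ℝ)..1, (((a + d) * bilinearUpper α γ δ x z
          - d / (2 * (α + γ + δ)) * bilinearUpper α γ δ x z ^ 2)
        - (a * bilinearLower α γ δ x z
          + d / (2 * (α + γ + δ)) * bilinearLower α γ δ x z ^ 2)) := by
    refine intervalIntegral.integral_congr fun x hx => intervalIntegral.integral_congr fun z hz => ?_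
    rw [uIcc_of_le zero_le_one] at hx hz
    exact inner x hx z hz
  rw [outer]
  generalize d / (2 * (α + γ + δ)) = h
  rw [integral_square_sub
      (F := fun x z => (a + d) * bilinearUpper α γ δ x z - h * bilinearUpper α γ δ x z ^ 2)
      (G := fun x z => a * bilinearLower α γ δ x z + h * bilinearLower α γ δ x z ^ 2)
      (by unfold Function.uncurry bilinearUpper; fun_prop)
      (by unfold Function.uncurry bilinearLower; fun_prop),
    integral_square_of_diagonal (fun x => by unfold bilinearUpper; fun_prop)
      0 ((a + d) * α) ((a + d) * (γ + δ)) (-h * α ^ 2) (-h * (2 * α * (γ + δ)))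
      (-h * (γ + δ) ^ 2)
      0 ((a + d) * (α + δ)) ((a + d) * γ) (-h * (α + δ) ^ 2) (-h * (2 * (α + δ) * γ))
      (-h * γ ^ 2),
    integral_square_of_antidiagonal (fun x => by unfold bilinearLower; fun_prop)
      0 (a * α) (a * γ) (h * α ^ 2) (h * (2 * α * γ)) (h * γ ^ 2)
      (-(a * δ) + h * δ ^ 2) (a * (α + δ) - 2 * h * δ * (α + δ))
      (a * (γ + δ) - 2 * h * δ * (γ + δ)) (h * (α + δ) ^ 2) (h * (2 * (α + δ) * (γ + δ)))
      (h * (γ + δ) ^ 2)]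
  · ring
  · intro x hx z hz hxz
    have : bilinearLower α γ δ x z = α * x + γ * z := max_eq_left (by nlinarith)
    rw [this, quadPoly]
    ring
  · intro x hx z hz hxz
    have : bilinearLower α γ δ x z = α * x + γ * z + δ * (x + z - 1) := max_eq_right (by nlinarith)
    rw [this, quadPoly]
    ring
  · intro x hx z hz hxz
    have : bilinearUpper α γ δ x z = α * x + (γ + δ) * z := min_eq_right (by nlinarith)
    rw [this, quadPoly]
    ring
  · intro x hx z hz hxz
    have : bilinearUpper α γ δ x z = (α + δ) * x + γ * z := min_eq_left (by nlinarith)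
    rw [this, quadPoly]
    ring

/-- Subtracting a₁a₃x₂ replaces x₁x₃ by w = x₁x₃ - a₁a₃, whose McCormick envelopes on the square are
`bilinearLower` and `bilinearUpper`. -/
theorem mem_polytopeP2_iff {a₁ b₁ a₂ b₂ a₃ b₃ : ℝ}
    (ha₁ : 0 ≤ a₁) (hb₁ : a₁ < b₁) (ha₂ : 0 ≤ a₂) (hb₂ : a₂ < b₂) (ha₃ : 0 ≤ a₃) (hb₃ : a₃ < b₃)
    (f x y z : ℝ) :
    ![f, a₁ + (b₁ - a₁) * x, a₂ + (b₂ - a₂) * y, a₃ + (b₃ - a₃) * z]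
        ∈ polytopeP2 a₁ b₁ a₂ b₂ a₃ b₃ ↔
      x ∈ Icc (0 : ℝ) 1 ∧ y ∈ Icc (0 : ℝ) 1 ∧ z ∈ Icc (0 : ℝ) 1 ∧
      a₁ * a₃ * (a₂ + (b₂ - a₂) * y) + doubleLower a₂ (b₂ - a₂) (a₃ * (b₁ - a₁)) (a₁ * (b₃ - a₃))
        ((b₁ - a₁) * (b₃ - a₃)) x y z ≤ f ∧
      f ≤ a₁ * a₃ * (a₂ + (b₂ - a₂) * y) + doubleUpper a₂ (b₂ - a₂) (a₃ * (b₁ - a₁))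
        (a₁ * (b₃ - a₃)) ((b₁ - a₁) * (b₃ - a₃)) x y z := by
  obtain ⟨d₁, rfl⟩ : ∃ d, b₁ = a₁ + d := ⟨b₁ - a₁, by ring⟩
  obtain ⟨d₂, rfl⟩ : ∃ d, b₂ = a₂ + d := ⟨b₂ - a₂, by ring⟩
  obtain ⟨d₃, rfl⟩ : ∃ d, b₃ = a₃ + d := ⟨b₃ - a₃, by ring⟩
  simp only [add_sub_cancel_left]
  have h₁ : 0 < d₁ := by linarith
  have h₂ : 0 < d₂ := by linarith
  have h₃ : 0 < d₃ := by linarith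
  have box : ∀ a d t : ℝ, 0 < d → (t ∈ Icc (0 : ℝ) 1 ↔
      0 ≤ a + d * t - a ∧ 0 ≤ -(a + d * t) + (a + d)) := by
    intro a d t hd
    constructor
    · rintro ⟨h0, h1⟩
      constructor <;> nlinarith
    · rintro ⟨h0, h1⟩
      constructor <;> nlinarith
  change DoubleMcCormick _ _ _ _ _ _ f (a₁ + d₁ * x) (a₃ + d₃ * z) (a₂ + d₂ * y) ↔ _
  unfold DoubleMcCormick
  rw [← le_sub_iff_add_le', ← sub_le_iff_le_add' (b := a₁ * a₃ * (a₂ + d₂ * y)), doubleLower, doubleUpper, bilinearLower,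
    bilinearUpper, mul_max_add_mul_posPart_le_iff ha₂ h₂.le,
    le_mul_min_sub_mul_posPart_iff ha₂ h₂.le]
  constructor
  · rintro ⟨x0, z0, l₁, l₂, z1, x1, l₃, l₄, u₁, u₂, y1, u₃, u₄, y0, -, -⟩
    refine ⟨(box a₁ d₁ x h₁).2 ⟨x0, x1⟩, (box a₂ d₂ y h₂).2 ⟨y0, y1⟩, (box a₃ d₃ z h₃).2 ⟨z0, z1⟩,
      ⟨?_, ?_, ?_, ?_⟩, ?_, ?_, ?_, ?_⟩
    · linarith only [l₁]
    · linarith only [l₃]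
    · linarith only [l₂]
    · linarith only [l₄]
    · linarith only [u₁]
    · linarith only [u₂]
    · linarith only [u₃]
    · linarith only [u₄]
  · rintro ⟨hx, hy, hz, ⟨l₁, l₃, l₂, l₄⟩, u₁, u₂, u₃, u₄⟩
    obtain ⟨x0, x1⟩ := (box a₁ d₁ x h₁).1 hx
    obtain ⟨y0, y1⟩ := (box a₂ d₂ y h₂).1 hy
    obtain ⟨z0, z1⟩ := (box a₃ d₃ z h₃).1 hz
    -- The bounds a₁a₃x₂ ≤ f ≤ b₁b₃x₂ follow from the others; these are the nonnegative terms by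
    -- which they are weaker.
    have n₁ : 0 ≤ a₂ * (a₃ * d₁ * x) := mul_nonneg ha₂ (mul_nonneg (by positivity) hx.1)
    have n₂ : 0 ≤ a₂ * (a₁ * d₃ * z) := mul_nonneg ha₂ (mul_nonneg (by positivity) hz.1)
    have n₃ : 0 ≤ a₂ * ((a₃ + d₃) * d₁ * (1 - x)) :=
      mul_nonneg ha₂ (mul_nonneg (by positivity) (sub_nonneg.2 hx.2))
    have n₄ : 0 ≤ a₂ * (a₁ * d₃ * (1 - z)) :=
      mul_nonneg ha₂ (mul_nonneg (by positivity) (sub_nonneg.2 hz.2))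
    refine ⟨x0, z0, ?_, ?_, z1, x1, ?_, ?_, ?_, ?_, y1, ?_, ?_, y0, ?_, ?_⟩
    · linarith only [l₁]
    · linarith only [l₂]
    · linarith only [l₃]
    · linarith only [l₄]
    · linarith only [u₁]
    · linarith only [u₂]
    · linarith only [u₃]
    · linarith only [u₄]
    · linarith only [l₁, n₁, n₂]
    · linarith only [u₃, n₃, n₄]

/-- The first summand is the value found for P_H in `volume_polytopeH`, so the second is the excess
volume. -/
theorem volume_polytopeP2 {a₁ b₁ a₂ b₂ a₃ b₃ : ℝ}
    (ha₁ : 0 ≤ a₁) (hb₁ : a₁ < b₁) (ha₂ : 0 ≤ a₂) (hb₂ : a₂ < b₂) (ha₃ : 0 ≤ a₃) (hb₃ : a₃ < b₃) :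
    volume (polytopeP2 a₁ b₁ a₂ b₂ a₃ b₃) = ENNReal.ofReal ((b₁ - a₁) * (b₂ - a₂) * (b₃ - a₃) *
      ((4 * (a₃ * (b₁ - a₁) * (b₂ - a₂)) + 4 * (a₂ * (b₁ - a₁) * (b₃ - a₃))
        + 2 * (a₁ * (b₂ - a₂) * (b₃ - a₃)) + 5 * ((b₁ - a₁) * (b₂ - a₂) * (b₃ - a₃))) / 24)
      + (b₁ - a₁) * (b₂ - a₂) ^ 2 * (b₃ - a₃) ^ 2
        * (5 * (a₁ * b₁ * b₃ - a₁ * b₁ * a₃) + 3 * (b₁ ^ 2 * a₃ - a₁ ^ 2 * b₃))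
        / (24 * (b₁ * b₃ - a₁ * a₃))) := by
  have h₁ : 0 < b₁ - a₁ := sub_pos.2 hb₁
  have h₂ : 0 < b₂ - a₂ := sub_pos.2 hb₂
  have h₃ : 0 < b₃ - a₃ := sub_pos.2 hb₃
  have hα : 0 ≤ a₃ * (b₁ - a₁) := by positivity
  have hγ : 0 ≤ a₁ * (b₃ - a₃) := by positivity
  have hδ : 0 < (b₁ - a₁) * (b₃ - a₃) := by positivity
  rw [volume_between_normalized_graphs hb₁ hb₂ hb₃ (by unfold doubleLower bilinearLower; fun_prop)
    (by unfold doubleUpper bilinearUpper; fun_prop) ?_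
    (mem_polytopeP2_iff ha₁ hb₁ ha₂ hb₂ ha₃ hb₃)]
  · simp only [add_sub_add_left_eq_sub]
    rw [integral_doubleUpper_sub_doubleLower _ _ hα hγ hδ]
    congr 1
    have e : a₃ * (b₁ - a₁) + a₁ * (b₃ - a₃) + (b₁ - a₁) * (b₃ - a₃) = b₁ * b₃ - a₁ * a₃ := by ring
    have hD : b₁ * b₃ - a₁ * a₃ ≠ 0 := by
      rw [← e]
      positivity
    rw [e]
    field_simp
    ring
  · intro x hx y hy z hz
    have := doubleLower_le_doubleUpper (a := a₂) (d := b₂ - a₂) ha₂ h₂.le hα hγ hδ.le hx hy hz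
    linarith only [this]

/-! ### Extreme points of P₂. -/

/-- The double-McCormick relaxation in normalised coordinates `[t, x, y, z]`, over the unit cube. -/
def normalizedDouble (a d α γ δ : ℝ) : Set (Fin 4 → ℝ) :=
  {v | v 1 ∈ Icc (0 : ℝ) 1 ∧ v 2 ∈ Icc (0 : ℝ) 1 ∧ v 3 ∈ Icc (0 : ℝ) 1 ∧
    doubleLower a d α γ δ (v 1) (v 2) (v 3) ≤ v 0 ∧ v 0 ≤ doubleUpper a d α γ δ (v 1) (v 2) (v 3)}

/-- The vertices of the normalised double-McCormick relaxation. -/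
def normalizedVertices (a d α γ δ : ℝ) : Set (Fin 4 → ℝ) :=
  {![a * α, 1, 0, 0], ![0, 0, 0, 0], ![a * γ, 0, 0, 1], ![0, 0, 1, 0], ![(a + d) * γ, 0, 1, 1],
    ![(a + d) * (α + γ + δ), 1, 1, 1], ![(a + d) * α, 1, 1, 0], ![a * (α + γ + δ), 1, 0, 1]} ∪
  {![(a + d) * α, 1, α / (α + γ + δ), 0], ![(a + d) * γ, 0, γ / (α + γ + δ), 1],
    ![a * γ, 0, 1 - γ / (α + γ + δ), 1], ![a * α, 1, 1 - α / (α + γ + δ), 0]}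

theorem mem_of_segment {K : Set (Fin 4 → ℝ)} (hK : Convex ℝ K)
    {l t₀ x₀ y₀ z₀ t₁ x₁ y₁ z₁ t x y z : ℝ}
    (hl : l ∈ Icc (0 : ℝ) 1) (h₀ : ![t₀, x₀, y₀, z₀] ∈ K) (h₁ : ![t₁, x₁, y₁, z₁] ∈ K)
    (et : t = (1 - l) * t₀ + l * t₁) (ex : x = (1 - l) * x₀ + l * x₁)
    (ey : y = (1 - l) * y₀ + l * y₁) (ez : z = (1 - l) * z₀ + l * z₁) : ![t, x, y, z] ∈ K := by
  have := hK h₀ h₁ (sub_nonneg.2 hl.2) hl.1 (by ring)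
  convert this using 1
  rw [et, ex, ey, ez]
  ext i
  fin_cases i <;> simp

theorem mem_of_triangle {K : Set (Fin 4 → ℝ)} (hK : Convex ℝ K)
    {p q r t₀ x₀ y₀ z₀ t₁ x₁ y₁ z₁ t₂ x₂ y₂ z₂ t x y z : ℝ} (hp : 0 ≤ p) (hq : 0 ≤ q) (hr : 0 ≤ r)
    (hsum : p + q + r = 1) (h₀ : ![t₀, x₀, y₀, z₀] ∈ K) (h₁ : ![t₁, x₁, y₁, z₁] ∈ K)
    (h₂ : ![t₂, x₂, y₂, z₂] ∈ K)
    (et : t = p * t₀ + q * t₁ + r * t₂) (ex : x = p * x₀ + q * x₁ + r * x₂)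
    (ey : y = p * y₀ + q * y₁ + r * y₂) (ez : z = p * z₀ + q * z₁ + r * z₂) :
    ![t, x, y, z] ∈ K := by
  have := hK.sum_mem (t := Finset.univ) (w := ![p, q, r])
    (z := ![![t₀, x₀, y₀, z₀], ![t₁, x₁, y₁, z₁], ![t₂, x₂, y₂, z₂]])
    (by intro i _; fin_cases i <;> assumption) (by simpa [Fin.sum_univ_three] using hsum)
    (by intro i _; fin_cases i <;> assumption)
  convert this using 1
  rw [et, ex, ey, ez]
  ext i
  fin_cases i <;> simp [Fin.sum_univ_three]

/-- A convex set that contains points over the four corners of the unit square, with heights affine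
in the value of the bilinear function, contains the corresponding points of its envelopes. -/
theorem mem_of_corners {K : Set (Fin 4 → ℝ)} (hK : Convex ℝ K) {α γ δ m n k l x z : ℝ}
    (hδ : 0 ≤ δ) (hx : x ∈ Icc (0 : ℝ) 1) (hz : z ∈ Icc (0 : ℝ) 1)
    (h₀₀ : ![n, 0, l, 0] ∈ K) (h₁₀ : ![m * α + n, 1, k * α + l, 0] ∈ K)
    (h₀₁ : ![m * γ + n, 0, k * γ + l, 1] ∈ K)
    (h₁₁ : ![m * (α + γ + δ) + n, 1, k * (α + γ + δ) + l, 1] ∈ K) :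
    ![m * bilinearUpper α γ δ x z + n, x, k * bilinearUpper α γ δ x z + l, z] ∈ K ∧
    ![m * bilinearLower α γ δ x z + n, x, k * bilinearLower α γ δ x z + l, z] ∈ K := by
  constructor
  -- Each envelope is affine on the two triangles of its triangulation of the square, and the
  -- barycentric coordinates are the weights.
  · rcases le_total z x with h | h
    · have e : bilinearUpper α γ δ x z = α * x + (γ + δ) * z := min_eq_right (by nlinarith)
      rw [e]
      refine mem_of_triangle hK (sub_nonneg.2 hx.2) (sub_nonneg.2 h) hz.1 (by ring) h₀₀ h₁₀ h₁₁
        ?_ ?_ ?_ ?_ <;> ring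
    · have e : bilinearUpper α γ δ x z = (α + δ) * x + γ * z := min_eq_left (by nlinarith)
      rw [e]
      refine mem_of_triangle hK (sub_nonneg.2 hz.2) (sub_nonneg.2 h) hx.1 (by ring) h₀₀ h₀₁ h₁₁
        ?_ ?_ ?_ ?_ <;> ring
  · rcases le_total (x + z) 1 with h | h
    · have e : bilinearLower α γ δ x z = α * x + γ * z := max_eq_left (by nlinarith)
      rw [e]
      refine mem_of_triangle hK (sub_nonneg.2 h) hx.1 hz.1 (by ring) h₀₀ h₁₀ h₀₁
        ?_ ?_ ?_ ?_ <;> ring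
    · have e : bilinearLower α γ δ x z = α * x + γ * z + δ * (x + z - 1) :=
        max_eq_right (by nlinarith)
      rw [e]
      refine mem_of_triangle hK (sub_nonneg.2 h) (sub_nonneg.2 hz.2) (sub_nonneg.2 hx.2) (by ring)
        h₁₁ h₁₀ h₀₁ ?_ ?_ ?_ ?_ <;> ring

/-- The case c = 0 does occur, for instance where an envelope of w vanishes, so the ratio y/c cannot
be used directly. -/
theorem exists_eq_mul_of_le {y c : ℝ} (h0 : 0 ≤ y) (h : y ≤ c) : ∃ l ∈ Icc (0 : ℝ) 1, y = l * c := by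
  rcases (h0.trans h).eq_or_lt with rfl | hc
  · exact ⟨0, by simp, by linarith⟩
  · exact ⟨y / c, ⟨div_nonneg h0 hc.le, (div_le_one hc).2 h⟩, by field_simp⟩

/-- Each boundary graph has two sheets. On a sheet, let l be the relative position of y between its
ends. For fixed l, both the height and y are affine in the envelope value of w. Over the corners of
the square, such points lie on edges of the corner parallelograms, hence in K, and `mem_of_corners`
fills in the rest. Vertical segments then fill the region between the graphs. -/
theorem normalizedDouble_subset_of_convex {K : Set (Fin 4 → ℝ)} (hK : Convex ℝ K) {a d α γ δ : ℝ}
    (hα : 0 ≤ α) (hγ : 0 ≤ γ) (hδ : 0 < δ)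
    (hv : normalizedVertices a d α γ δ ⊆ K) : normalizedDouble a d α γ δ ⊆ K := by
  have hD : 0 < α + γ + δ := by positivity
  simp only [normalizedVertices, union_subset_iff, insert_subset_iff, singleton_subset_iff] at hv
  obtain ⟨⟨v1, v2, v3, v4, v5, v6, v7, v8⟩, v9, v10, v11, v12⟩ := hv
  set D := α + γ + δ with hDdef
  have graphs : ∀ x ∈ Icc (0 : ℝ) 1, ∀ y ∈ Icc (0 : ℝ) 1, ∀ z ∈ Icc (0 : ℝ) 1,
      ![doubleUpper a d α γ δ x y z, x, y, z] ∈ K ∧ ![doubleLower a d α γ δ x y z, x, y, z] ∈ K := by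
    intro x hx y hy z hz
    have b₀ := bilinearLower_nonneg (δ := δ) hα hγ hx hz
    have b₁ := bilinearLower_le_bilinearUpper (α := α) (γ := γ) hδ.le hx hz
    have b₂ := bilinearUpper_le hα hγ hδ.le hx hz
    unfold doubleUpper doubleLower
    rw [← hDdef] at b₂ ⊢
    constructor
    · rcases le_total (D * y) (bilinearUpper α γ δ x z) with h | h
      · obtain ⟨l, hl, hyl⟩ := exists_eq_mul_of_le hy.1
          (by rwa [le_div_iff₀' hD] : y ≤ bilinearUpper α γ δ x z / D)
        obtain rfl : y = l * (bilinearUpper α γ δ x z / D) := by linarith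
        have := (mem_of_corners hK (α := α) (γ := γ) (δ := δ) (m := a + l * d) (n := 0)
          (k := l / D) (l := 0) hδ.le hx hz ?_ ?_ ?_ ?_).1
        · rw [max_eq_left (by linarith)]
          convert this using 2
          · first | ring1 | (field_simp; ring1)
          · congr 2
            ring
        · refine mem_of_segment hK hl v2 v2 ?_ ?_ ?_ ?_ <;> ring
        · refine mem_of_segment hK hl v1 v9 ?_ ?_ ?_ ?_ <;> ring
        · refine mem_of_segment hK hl v3 v10 ?_ ?_ ?_ ?_ <;> ring
        · refine mem_of_segment hK hl v8 v6 ?_ ?_ ?_ ?_ <;>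
            first | ring1 | (field_simp; ring1)
      · obtain ⟨l, hl, hyl⟩ := exists_eq_mul_of_le (sub_nonneg.2 hy.2)
          (sub_le_sub_left ((div_le_iff₀' hD).2 h) 1)
        obtain rfl : y = 1 - l * (1 - bilinearUpper α γ δ x z / D) := by linarith
        have := (mem_of_corners hK (α := α) (γ := γ) (δ := δ) (m := a + d) (n := 0)
          (k := l / D) (l := 1 - l) hδ.le hx hz ?_ ?_ ?_ ?_).1
        · rw [max_eq_right (by linarith)]
          convert this using 2
          · ring
          · congr 2
            ring
        · refine mem_of_segment hK hl v4 v2 ?_ ?_ ?_ ?_ <;> ring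
        · refine mem_of_segment hK hl v7 v9 ?_ ?_ ?_ ?_ <;> ring
        · refine mem_of_segment hK hl v5 v10 ?_ ?_ ?_ ?_ <;> ring
        · refine mem_of_segment hK hl v6 v6 ?_ ?_ ?_ ?_ <;>
            first | ring1 | (field_simp; ring1)
    · rcases le_total (D * (y - 1) + bilinearLower α γ δ x z) 0 with h | h
      · obtain ⟨l, hl, hyl⟩ := exists_eq_mul_of_le hy.1
          (by rw [le_sub_comm, div_le_iff₀' hD]; linarith : y ≤ 1 - bilinearLower α γ δ x z / D)
        obtain rfl : y = l * (1 - bilinearLower α γ δ x z / D) := by linarith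
        have := (mem_of_corners hK (α := α) (γ := γ) (δ := δ) (m := a) (n := 0)
          (k := -(l / D)) (l := l) hδ.le hx hz ?_ ?_ ?_ ?_).2
        · rw [max_eq_right (by linarith)]
          convert this using 2
          · ring
          · congr 2
            ring
        · refine mem_of_segment hK hl v2 v4 ?_ ?_ ?_ ?_ <;> ring
        · refine mem_of_segment hK hl v1 v12 ?_ ?_ ?_ ?_ <;> ring
        · refine mem_of_segment hK hl v3 v11 ?_ ?_ ?_ ?_ <;> ring
        · refine mem_of_segment hK hl v8 v8 ?_ ?_ ?_ ?_ <;>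
            first | ring1 | (field_simp; ring1)
      · obtain ⟨l, hl, hyl⟩ := exists_eq_mul_of_le (sub_nonneg.2 hy.2)
          (by rw [le_div_iff₀' hD]; linarith : 1 - y ≤ bilinearLower α γ δ x z / D)
        obtain rfl : y = 1 - l * (bilinearLower α γ δ x z / D) := by linarith
        have := (mem_of_corners hK (α := α) (γ := γ) (δ := δ) (m := a + (1 - l) * d) (n := 0)
          (k := -(l / D)) (l := 1) hδ.le hx hz ?_ ?_ ?_ ?_).2
        · rw [max_eq_left (by linarith)]
          convert this using 2
          · first | ring1 | (field_simp; ring1)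
          · congr 2
            ring
        · refine mem_of_segment hK hl v4 v4 ?_ ?_ ?_ ?_ <;> ring
        · refine mem_of_segment hK hl v7 v12 ?_ ?_ ?_ ?_ <;> ring
        · refine mem_of_segment hK hl v5 v11 ?_ ?_ ?_ ?_ <;> ring
        · refine mem_of_segment hK hl v6 v8 ?_ ?_ ?_ ?_ <;>
            first | ring1 | (field_simp; ring1)
  rintro v ⟨hx, hy, hz, hl, hu⟩
  obtain ⟨gu, gl⟩ := graphs _ hx _ hy _ hz
  obtain ⟨l, hl, hvl⟩ := exists_eq_mul_of_le (sub_nonneg.2 hl) (sub_le_sub_right hu _)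
  have := mem_of_segment hK hl gl gu (t := v 0) (x := v 1) (y := v 2) (z := v 3)
    (by linarith) (by ring) (by ring) (by ring)
  convert this using 1
  ext i
  fin_cases i <;> rfl

/-- In the section of the double-McCormick relaxation over a corner of the unit square, where the
bilinear function has value `w`, every vertex is an extreme point of the whole relaxation. -/
theorem mem_extremePoints_normalizedDouble {a d α γ δ x z w : ℝ} (ha : 0 ≤ a) (hd : 0 < d)
    (hα : 0 ≤ α) (hγ : 0 ≤ γ) (hδ : 0 < δ) (hx : x = 0 ∨ x = 1) (hz : z = 0 ∨ z = 1)
    (hw : w = α * x + γ * z + δ * (x * z)) {t y : ℝ}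
    (hty : (t = a * w ∧ y = 0) ∨ (t = (a + d) * w ∧ y = 1) ∨
      (t = (a + d) * w ∧ y = w / (α + γ + δ)) ∨ (t = a * w ∧ y = 1 - w / (α + γ + δ))) :
    ![t, x, y, z] ∈ (normalizedDouble a d α γ δ).extremePoints ℝ := by
  have hD : 0 < α + γ + δ := by positivity
  have hxI : x ∈ Icc (0 : ℝ) 1 := by rcases hx with rfl | rfl <;> simp
  have hzI : z ∈ Icc (0 : ℝ) 1 := by rcases hz with rfl | rfl <;> simp
  have eL : bilinearLower α γ δ x z = w := by
    rw [hw]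
    rcases hx with rfl | rfl <;> rcases hz with rfl | rfl
    · exact (max_eq_left (by linarith)).trans (by ring)
    · exact (max_eq_left (by linarith)).trans (by ring)
    · exact (max_eq_left (by linarith)).trans (by ring)
    · exact (max_eq_right (by linarith)).trans (by ring)
  have eU : bilinearUpper α γ δ x z = w := by
    rw [hw]
    rcases hx with rfl | rfl <;> rcases hz with rfl | rfl
    · exact (min_eq_left (by linarith)).trans (by ring)
    · exact (min_eq_left (by linarith)).trans (by ring)
    · exact (min_eq_right (by linarith)).trans (by ring)
    · exact (min_eq_left (by linarith)).trans (by ring)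
  have w0 : 0 ≤ w := eL ▸ bilinearLower_nonneg hα hγ hxI hzI
  have wD : w ≤ α + γ + δ := eU ▸ bilinearUpper_le hα hγ hδ.le hxI hzI
  set D := α + γ + δ with hDdef
  have q0 : 0 ≤ w / D := div_nonneg w0 hD.le
  have q1 : w / D ≤ 1 := (div_le_one hD).2 wD
  have qw : D * (w / D) = w := mul_div_cancel₀ _ hD.ne'
  have dw : 0 ≤ d * w := mul_nonneg hd.le w0
  have dwD : 0 ≤ d * (D - w) := mul_nonneg hd.le (sub_nonneg.2 wD)
  have section_iff : ∀ t y : ℝ, ![t, x, y, z] ∈ normalizedDouble a d α γ δ ↔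
      y ∈ Icc (0 : ℝ) 1 ∧ (a * w ≤ t ∧ a * w + d * (D * (y - 1) + w) ≤ t) ∧
        t ≤ (a + d) * w ∧ t ≤ a * w + d * (D * y) := by
    intro t y
    change (x ∈ Icc (0 : ℝ) 1 ∧ y ∈ Icc (0 : ℝ) 1 ∧ z ∈ Icc (0 : ℝ) 1 ∧
      doubleLower a d α γ δ x y z ≤ t ∧ t ≤ doubleUpper a d α γ δ x y z) ↔ _
    have h₁ := mul_max_add_mul_posPart_le_iff ha hd.le w w (D * (y - 1)) t
    have h₂ := le_mul_min_sub_mul_posPart_iff ha hd.le w w (D * y) t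
    rw [max_self] at h₁
    rw [min_self] at h₂
    rw [doubleLower, doubleUpper, eL, eU, ← hDdef, h₁, h₂]
    exact ⟨fun ⟨_, hy, _, ⟨l₁, _, l₂, _⟩, u₁, _, u₂, _⟩ => ⟨hy, ⟨l₁, l₂⟩, u₁, u₂⟩,
      fun ⟨hy, ⟨l₁, l₂⟩, u₁, u₂⟩ => ⟨hxI, hy, hzI, ⟨l₁, l₁, l₂, l₂⟩, u₁, u₁, u₂, u₂⟩⟩
  have hmem : ![t, x, y, z] ∈ normalizedDouble a d α γ δ := by
    rw [section_iff]
    rcases hty with ⟨rfl, rfl⟩ | ⟨rfl, rfl⟩ | ⟨rfl, rfl⟩ | ⟨rfl, rfl⟩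
    · exact ⟨by simp, ⟨le_rfl, by linarith⟩, by linarith, by linarith⟩
    · exact ⟨by simp, ⟨by linarith, by linarith⟩, le_rfl, by linarith⟩
    · refine ⟨⟨q0, q1⟩, ⟨by linarith, ?_⟩, le_rfl, ?_⟩
      · rw [mul_sub, qw]
        linarith
      · rw [qw]
        linarith
    · refine ⟨⟨by linarith, by linarith⟩, ⟨le_rfl, ?_⟩, by linarith, ?_⟩
      · rw [sub_sub_cancel_left, mul_neg, qw]
        linarith
      · rw [mul_sub, qw]
        linarith
  -- A constraint that is tight at an interior point of a segment is tight at both ends.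
  have tight : ∀ {s t g h : ℝ}, 0 < s → 0 < t → 0 ≤ g → 0 ≤ h → s * g + t * h = 0 →
      g = 0 ∧ h = 0 := by
    intro s t g h hs ht hg hh e
    have h₁ := mul_nonneg hs.le hg
    have h₂ := mul_nonneg ht.le hh
    constructor
    · exact (mul_eq_zero.1 (by linarith : s * g = 0)).resolve_left hs.ne'
    · exact (mul_eq_zero.1 (by linarith : t * h = 0)).resolve_left ht.ne'
  have endpoint : ∀ {s t g h c : ℝ}, 0 < s → 0 < t → s + t = 1 → g ∈ Icc (0 : ℝ) 1 →
      h ∈ Icc (0 : ℝ) 1 → c = 0 ∨ c = 1 → s * g + t * h = c → g = c ∧ h = c := by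
    intro s t g h c hs ht hst hg hh hc e
    rcases hc with rfl | rfl
    · exact tight hs ht hg.1 hh.1 e
    · obtain ⟨h₁, h₂⟩ := tight hs ht (sub_nonneg.2 hg.2) (sub_nonneg.2 hh.2) (by linarith)
      constructor <;> linarith
  refine mem_extremePoints_iff_left.2 ⟨hmem, ?_⟩
  rintro p hp q hq ⟨r, s, hr, hs, hrs, e⟩
  have e0 : r * p 0 + s * q 0 = t := by simpa using congrFun e 0
  have e1 : r * p 1 + s * q 1 = x := by simpa using congrFun e 1
  have e2 : r * p 2 + s * q 2 = y := by simpa using congrFun e 2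
  have e3 : r * p 3 + s * q 3 = z := by simpa using congrFun e 3
  -- As x and z are endpoints of [0, 1], every segment through the point stays in the section over
  -- this corner, and the problem becomes planar.
  obtain ⟨p1, q1⟩ := endpoint hr hs hrs hp.1 hq.1 hx e1
  obtain ⟨p3, q3⟩ := endpoint hr hs hrs hp.2.2.1 hq.2.2.1 hz e3
  have ep : p = ![p 0, x, p 2, z] := by
    rw [← p1, ← p3]
    ext i
    fin_cases i <;> rfl
  have eq : q = ![q 0, x, q 2, z] := by
    rw [← q1, ← q3]
    ext i
    fin_cases i <;> rfl
  rw [ep, section_iff] at hp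
  rw [eq, section_iff] at hq
  obtain ⟨pI, ⟨pl₁, pl₂⟩, pu₁, pu₂⟩ := hp
  obtain ⟨qI, ⟨ql₁, ql₂⟩, qu₁, qu₂⟩ := hq
  obtain rfl : s = 1 - r := by linarith
  have hdD : 0 < d * D := mul_pos hd hD
  have main : p 0 = t ∧ p 2 = y := by
    rcases hty with ⟨rfl, rfl⟩ | ⟨rfl, rfl⟩ | ⟨rfl, rfl⟩ | ⟨rfl, rfl⟩
    · obtain ⟨h, -⟩ := endpoint hr hs (by ring) pI qI (Or.inl rfl) e2
      rw [h] at pu₂ ⊢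
      exact ⟨by linarith, rfl⟩
    · obtain ⟨h, -⟩ := endpoint hr hs (by ring) pI qI (Or.inr rfl) e2
      rw [h] at pl₂ ⊢
      exact ⟨by linarith, rfl⟩
    -- Both upper constraints are tight here, and their boundary lines meet in a single point
    -- because dD ≠ 0. The last case uses the two lower constraints in the same way.
    · obtain ⟨h₁, -⟩ := tight hr hs (sub_nonneg.2 pu₁) (sub_nonneg.2 qu₁) (by linarith)
      obtain ⟨h₂, -⟩ := tight hr hs (sub_nonneg.2 pu₂) (sub_nonneg.2 qu₂) (by
        linear_combination d * D * e2 - e0 + d * qw)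
      refine ⟨by linarith, ?_⟩
      rw [eq_div_iff hD.ne']
      have : d * (p 2 * D - w) = 0 := by linarith
      linarith [(mul_eq_zero.1 this).resolve_left hd.ne']
    · obtain ⟨h₁, -⟩ := tight hr hs (sub_nonneg.2 pl₁) (sub_nonneg.2 ql₁) (by linarith)
      obtain ⟨h₂, -⟩ := tight hr hs (sub_nonneg.2 pl₂) (sub_nonneg.2 ql₂) (by
        linear_combination -(d * D * e2) + e0 + d * qw)
      refine ⟨by linarith, ?_⟩
      rw [eq_sub_iff_add_eq, ← eq_sub_iff_add_eq', div_eq_iff hD.ne']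
      have : d * (D * (p 2 - 1) + w) = 0 := by linarith
      linarith [(mul_eq_zero.1 this).resolve_left hd.ne']
  rw [ep, main.1, main.2]

theorem normalizedVertices_subset_extremePoints {a d α γ δ : ℝ} (ha : 0 ≤ a) (hd : 0 < d)
    (hα : 0 ≤ α) (hγ : 0 ≤ γ) (hδ : 0 < δ) :
    normalizedVertices a d α γ δ ⊆ (normalizedDouble a d α γ δ).extremePoints ℝ := by
  have h := fun {x z w t y : ℝ} => mem_extremePoints_normalizedDouble (x := x) (z := z) (w := w)
    (t := t) (y := y) ha hd hα hγ hδ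
  simp only [normalizedVertices, union_subset_iff, insert_subset_iff, singleton_subset_iff]
  refine ⟨⟨?_, ?_, ?_, ?_, ?_, ?_, ?_, ?_⟩, ?_, ?_, ?_, ?_⟩
  · exact h (w := α) (.inr rfl) (.inl rfl) (by ring) (.inl ⟨rfl, rfl⟩)
  · exact h (w := 0) (.inl rfl) (.inl rfl) (by ring) (.inl ⟨by ring, rfl⟩)
  · exact h (w := γ) (.inl rfl) (.inr rfl) (by ring) (.inl ⟨rfl, rfl⟩)
  · exact h (w := 0) (.inl rfl) (.inl rfl) (by ring) (.inr (.inl ⟨by ring, rfl⟩))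
  · exact h (w := γ) (.inl rfl) (.inr rfl) (by ring) (.inr (.inl ⟨rfl, rfl⟩))
  · exact h (w := α + γ + δ) (.inr rfl) (.inr rfl) (by ring) (.inr (.inl ⟨rfl, rfl⟩))
  · exact h (w := α) (.inr rfl) (.inl rfl) (by ring) (.inr (.inl ⟨rfl, rfl⟩))
  · exact h (w := α + γ + δ) (.inr rfl) (.inr rfl) (by ring) (.inl ⟨rfl, rfl⟩)
  · exact h (w := α) (.inr rfl) (.inl rfl) (by ring) (.inr (.inr (.inl ⟨rfl, rfl⟩)))
  · exact h (w := γ) (.inl rfl) (.inr rfl) (by ring) (.inr (.inr (.inl ⟨rfl, rfl⟩)))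
  · exact h (w := γ) (.inl rfl) (.inr rfl) (by ring) (.inr (.inr (.inr ⟨rfl, rfl⟩)))
  · exact h (w := α) (.inr rfl) (.inl rfl) (by ring) (.inr (.inr (.inr ⟨rfl, rfl⟩)))

theorem convex_polytopeP2 (a₁ b₁ a₂ b₂ a₃ b₃ : ℝ) : Convex ℝ (polytopeP2 a₁ b₁ a₂ b₂ a₃ b₃) := by
  intro p hp q hq s t hs ht hst
  obtain rfl : s = 1 - t := by linarith
  change DoubleMcCormick _ _ _ _ _ _ ((1 - t) * p 0 + t * q 0) ((1 - t) * p 1 + t * q 1)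
    ((1 - t) * p 3 + t * q 3) ((1 - t) * p 2 + t * q 2)
  have comb : ∀ {g h k : ℝ}, 0 ≤ g → 0 ≤ h → k = (1 - t) * g + t * h → 0 ≤ k :=
    fun hg hh e => e ▸ add_nonneg (mul_nonneg hs hg) (mul_nonneg ht hh)
  obtain ⟨p1, p2, p3, p4, p5, p6, p7, p8, p9, p10, p11, p12, p13, p14, p15, p16⟩ := hp
  obtain ⟨q1, q2, q3, q4, q5, q6, q7, q8, q9, q10, q11, q12, q13, q14, q15, q16⟩ := hq
  exact ⟨comb p1 q1 (by ring), comb p2 q2 (by ring), comb p3 q3 (by ring), comb p4 q4 (by ring),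
    comb p5 q5 (by ring), comb p6 q6 (by ring), comb p7 q7 (by ring), comb p8 q8 (by ring),
    comb p9 q9 (by ring), comb p10 q10 (by ring), comb p11 q11 (by ring), comb p12 q12 (by ring),
    comb p13 q13 (by ring), comb p14 q14 (by ring), comb p15 q15 (by ring), comb p16 q16 (by ring)⟩

/-- The affine bijection from normalised coordinates `[t, x, y, z]` over the unit cube to
coordinates `[f, x₁, x₂, x₃]` over the box. -/
def boxMap (a₁ b₁ a₂ b₂ a₃ b₃ : ℝ) (v : Fin 4 → ℝ) : Fin 4 → ℝ :=
  ![a₁ * a₃ * (a₂ + (b₂ - a₂) * v 2) + v 0, a₁ + (b₁ - a₁) * v 1, a₂ + (b₂ - a₂) * v 2,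
    a₃ + (b₃ - a₃) * v 3]

theorem boxMap_add_smul {s t : ℝ} (h : s + t = 1) (a₁ b₁ a₂ b₂ a₃ b₃ : ℝ) (v w : Fin 4 → ℝ) :
    boxMap a₁ b₁ a₂ b₂ a₃ b₃ (s • v + t • w)
      = s • boxMap a₁ b₁ a₂ b₂ a₃ b₃ v + t • boxMap a₁ b₁ a₂ b₂ a₃ b₃ w := by
  obtain rfl : s = 1 - t := by linarith
  ext i
  fin_cases i <;> simp [boxMap] <;> ring

theorem boxMap_injective {a₁ b₁ a₂ b₂ a₃ b₃ : ℝ} (h₁ : a₁ < b₁) (h₂ : a₂ < b₂) (h₃ : a₃ < b₃) :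
    Function.Injective (boxMap a₁ b₁ a₂ b₂ a₃ b₃) := by
  intro v w h
  have e0 : a₁ * a₃ * (a₂ + (b₂ - a₂) * v 2) + v 0 = a₁ * a₃ * (a₂ + (b₂ - a₂) * w 2) + w 0 :=
    congrFun h 0
  have e1 : a₁ + (b₁ - a₁) * v 1 = a₁ + (b₁ - a₁) * w 1 := congrFun h 1
  have e2 : a₂ + (b₂ - a₂) * v 2 = a₂ + (b₂ - a₂) * w 2 := congrFun h 2
  have e3 : a₃ + (b₃ - a₃) * v 3 = a₃ + (b₃ - a₃) * w 3 := congrFun h 3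
  ext i
  fin_cases i
  · rw [e2] at e0
    exact add_left_cancel e0
  · exact mul_left_cancel₀ (sub_pos.2 h₁).ne' (add_left_cancel e1)
  · exact mul_left_cancel₀ (sub_pos.2 h₂).ne' (add_left_cancel e2)
  · exact mul_left_cancel₀ (sub_pos.2 h₃).ne' (add_left_cancel e3)

theorem boxMap_image_normalizedDouble {a₁ b₁ a₂ b₂ a₃ b₃ : ℝ}
    (ha₁ : 0 ≤ a₁) (hb₁ : a₁ < b₁) (ha₂ : 0 ≤ a₂) (hb₂ : a₂ < b₂) (ha₃ : 0 ≤ a₃) (hb₃ : a₃ < b₃) :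
    boxMap a₁ b₁ a₂ b₂ a₃ b₃ '' normalizedDouble a₂ (b₂ - a₂) (a₃ * (b₁ - a₁)) (a₁ * (b₃ - a₃))
      ((b₁ - a₁) * (b₃ - a₃)) = polytopeP2 a₁ b₁ a₂ b₂ a₃ b₃ := by
  apply Subset.antisymm
  · rintro _ ⟨v, ⟨hx, hy, hz, hl, hu⟩, rfl⟩
    exact (mem_polytopeP2_iff ha₁ hb₁ ha₂ hb₂ ha₃ hb₃ _ _ _ _).2
      ⟨hx, hy, hz, by linarith, by linarith⟩
  · intro p hp
    have rep : ∀ {a b : ℝ}, a < b → ∀ t : ℝ, a + (b - a) * ((t - a) / (b - a)) = t := by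
      intro a b hab t
      rw [mul_div_cancel₀ _ (sub_pos.2 hab).ne', add_sub_cancel]
    have e : ![p 0, a₁ + (b₁ - a₁) * ((p 1 - a₁) / (b₁ - a₁)),
        a₂ + (b₂ - a₂) * ((p 2 - a₂) / (b₂ - a₂)),
        a₃ + (b₃ - a₃) * ((p 3 - a₃) / (b₃ - a₃))] = p := by
      rw [rep hb₁, rep hb₂, rep hb₃]
      ext i
      fin_cases i <;> rfl
    rw [← e, mem_polytopeP2_iff ha₁ hb₁ ha₂ hb₂ ha₃ hb₃] at hp
    obtain ⟨hx, hy, hz, hl, hu⟩ := hp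
    refine ⟨![p 0 - a₁ * a₃ * p 2, (p 1 - a₁) / (b₁ - a₁), (p 2 - a₂) / (b₂ - a₂),
      (p 3 - a₃) / (b₃ - a₃)], ⟨hx, hy, hz, ?_, ?_⟩, ?_⟩
    · rw [rep hb₂] at hl
      exact le_sub_iff_add_le'.2 hl
    · rw [rep hb₂] at hu
      exact sub_le_iff_le_add'.2 hu
    · conv_rhs => rw [← e]
      have : a₁ * a₃ * (a₂ + (b₂ - a₂) * ((p 2 - a₂) / (b₂ - a₂))) + (p 0 - a₁ * a₃ * p 2)
          = p 0 := by
        rw [rep hb₂]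
        ring
      exact congrArg (fun f => ![f, a₁ + (b₁ - a₁) * ((p 1 - a₁) / (b₁ - a₁)),
        a₂ + (b₂ - a₂) * ((p 2 - a₂) / (b₂ - a₂)),
        a₃ + (b₃ - a₃) * ((p 3 - a₃) / (b₃ - a₃))]) this

theorem boxMap_image_normalizedVertices {a₁ b₁ a₂ b₂ a₃ b₃ : ℝ}
    (ha₁ : 0 ≤ a₁) (hb₁ : a₁ < b₁) (ha₃ : 0 ≤ a₃) (hb₃ : a₃ < b₃) :
    boxMap a₁ b₁ a₂ b₂ a₃ b₃ '' normalizedVertices a₂ (b₂ - a₂) (a₃ * (b₁ - a₁)) (a₁ * (b₃ - a₃))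
      ((b₁ - a₁) * (b₃ - a₃)) = hullPoints a₁ b₁ a₂ b₂ a₃ b₃ ∪ extraPoints2 a₁ b₁ a₂ b₂ a₃ b₃ := by
  have e : a₃ * (b₁ - a₁) + a₁ * (b₃ - a₃) + (b₁ - a₁) * (b₃ - a₃) = b₃ * b₁ - a₃ * a₁ := by ring
  have hD : b₃ * b₁ - a₃ * a₁ ≠ 0 := by
    rw [← e]
    have := mul_pos (sub_pos.2 hb₁) (sub_pos.2 hb₃)
    have := mul_nonneg ha₃ (sub_pos.2 hb₁).le
    have := mul_nonneg ha₁ (sub_pos.2 hb₃).le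
    positivity
  -- The denominator stays an atom while fractions are cleared and is expanded only afterwards.
  obtain ⟨D, hDe⟩ : ∃ D, D = b₃ * b₁ - a₃ * a₁ := ⟨_, rfl⟩
  rw [← hDe] at hD e
  have vec : ∀ {t x y z f x₁ x₂ x₃ : ℝ}, a₁ * a₃ * (a₂ + (b₂ - a₂) * y) + t = f →
      a₁ + (b₁ - a₁) * x = x₁ → a₂ + (b₂ - a₂) * y = x₂ → a₃ + (b₃ - a₃) * z = x₃ →
      boxMap a₁ b₁ a₂ b₂ a₃ b₃ ![t, x, y, z] = ![f, x₁, x₂, x₃] := by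
    rintro t x y z _ _ _ _ rfl rfl rfl rfl
    rfl
  rw [normalizedVertices, e, image_union]
  simp only [image_insert_eq, image_singleton, hullPoints, extraPoints2]
  congr 1
  · congr 1
    · exact vec (by ring) (by ring) (by ring) (by ring)
    congr 1
    · exact vec (by ring) (by ring) (by ring) (by ring)
    congr 1
    · exact vec (by ring) (by ring) (by ring) (by ring)
    congr 1
    · exact vec (by ring) (by ring) (by ring) (by ring)
    congr 1
    · exact vec (by ring) (by ring) (by ring) (by ring)
    congr 1
    · exact vec (by linear_combination b₂ * hDe) (by ring) (by ring) (by ring)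
    congr 1
    · exact vec (by ring) (by ring) (by ring) (by ring)
    congr 1
    · exact vec (by linear_combination a₂ * hDe) (by ring) (by ring) (by ring)
  · congr 1
    · exact vec (by rw [theta1, ← hDe]; field_simp; rw [hDe]; ring) (by ring)
        (by rw [theta2, ← hDe]; field_simp) (by ring)
    congr 1
    · exact vec (by rw [theta3, ← hDe]; field_simp; rw [hDe]; ring) (by ring)
        (by rw [theta4, ← hDe]; field_simp) (by ring)
    congr 1
    · exact vec (by rw [theta5, ← hDe]; field_simp; rw [hDe]; ring) (by ring)
        (by rw [theta6, ← hDe]; field_simp; rw [hDe]; ring) (by ring)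
    congr 1
    · exact vec (by rw [theta7, ← hDe]; field_simp; rw [hDe]; ring) (by ring)
        (by rw [theta8, ← hDe]; field_simp; rw [hDe]; ring) (by ring)

theorem extremePoints_polytopeP2 {a₁ b₁ a₂ b₂ a₃ b₃ : ℝ}
    (ha₁ : 0 ≤ a₁) (hb₁ : a₁ < b₁) (ha₂ : 0 ≤ a₂) (hb₂ : a₂ < b₂) (ha₃ : 0 ≤ a₃) (hb₃ : a₃ < b₃) :
    (polytopeP2 a₁ b₁ a₂ b₂ a₃ b₃).extremePoints ℝ
      = hullPoints a₁ b₁ a₂ b₂ a₃ b₃ ∪ extraPoints2 a₁ b₁ a₂ b₂ a₃ b₃ := by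
  have hα : 0 ≤ a₃ * (b₁ - a₁) := mul_nonneg ha₃ (sub_pos.2 hb₁).le
  have hγ : 0 ≤ a₁ * (b₃ - a₃) := mul_nonneg ha₁ (sub_pos.2 hb₃).le
  have hδ : 0 < (b₁ - a₁) * (b₃ - a₃) := mul_pos (sub_pos.2 hb₁) (sub_pos.2 hb₃)
  have hext := normalizedVertices_subset_extremePoints ha₂ (sub_pos.2 hb₂) hα hγ hδ
  have hconv := convex_polytopeP2 a₁ b₁ a₂ b₂ a₃ b₃
  rw [← boxMap_image_normalizedDouble ha₁ hb₁ ha₂ hb₂ ha₃ hb₃] at hconv ⊢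
  rw [← boxMap_image_normalizedVertices ha₁ hb₁ ha₃ hb₃]
  set P := normalizedDouble a₂ (b₂ - a₂) (a₃ * (b₁ - a₁)) (a₁ * (b₃ - a₃)) ((b₁ - a₁) * (b₃ - a₃))
  set V := normalizedVertices a₂ (b₂ - a₂) (a₃ * (b₁ - a₁)) (a₁ * (b₃ - a₃))
    ((b₁ - a₁) * (b₃ - a₃))
  apply Subset.antisymm
  -- Pulling the hull of the listed points back to the cube gives a convex set containing the
  -- normalised vertices, hence the normalised relaxation. So P₂ is that hull.
  · have hK : Convex ℝ (boxMap a₁ b₁ a₂ b₂ a₃ b₃ ⁻¹'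
        convexHull ℝ (boxMap a₁ b₁ a₂ b₂ a₃ b₃ '' V)) := by
      intro p hp q hq s t hs ht hst
      rw [mem_preimage, boxMap_add_smul hst]
      exact convex_convexHull ℝ _ hp hq hs ht hst
    have hsub : P ⊆ boxMap a₁ b₁ a₂ b₂ a₃ b₃ ⁻¹'
        convexHull ℝ (boxMap a₁ b₁ a₂ b₂ a₃ b₃ '' V) :=
      normalizedDouble_subset_of_convex hK hα hγ hδ
        (image_subset_iff.1 (subset_convexHull ℝ _))
    have heq : boxMap a₁ b₁ a₂ b₂ a₃ b₃ '' P = convexHull ℝ (boxMap a₁ b₁ a₂ b₂ a₃ b₃ '' V) :=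
      Subset.antisymm (image_subset_iff.2 hsub)
        (convexHull_min (image_mono (hext.trans extremePoints_subset)) hconv)
    rw [heq]
    exact extremePoints_convexHull_subset
  · rintro _ ⟨v, hv, rfl⟩
    obtain ⟨hvP, hv⟩ := mem_extremePoints_iff_left.1 (hext hv)
    refine mem_extremePoints_iff_left.2 ⟨mem_image_of_mem _ hvP, ?_⟩
    rintro _ ⟨p, hp, rfl⟩ _ ⟨q, hq, rfl⟩ ⟨s, t, hs, ht, hst, e⟩
    rw [← boxMap_add_smul hst] at e
    rw [hv p hp q hq ⟨s, t, hs, ht, hst, boxMap_injective hb₁ hb₂ hb₃ e⟩]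

/-! ### Comparison of the two volumes. -/

theorem theorem3 (a₁ b₁ a₂ b₂ a₃ b₃ : ℝ)
    (ha₁ : 0 ≤ a₁) (hb₁ : a₁ < b₁) (ha₂ : 0 ≤ a₂) (hb₂ : a₂ < b₂) (ha₃ : 0 ≤ a₃) (hb₃ : a₃ < b₃)
    (hΩ₁ : a₁ * b₂ * b₃ + b₁ * a₂ * a₃ ≤ b₁ * a₂ * b₃ + a₁ * b₂ * a₃)
    (hΩ₂ : b₁ * a₂ * b₃ + a₁ * b₂ * a₃ ≤ b₁ * b₂ * a₃ + a₁ * a₂ * b₃) :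
    (polytopeP2 a₁ b₁ a₂ b₂ a₃ b₃).extremePoints ℝ
        = hullPoints a₁ b₁ a₂ b₂ a₃ b₃ ∪ extraPoints2 a₁ b₁ a₂ b₂ a₃ b₃ ∧
      volume (polytopeP2 a₁ b₁ a₂ b₂ a₃ b₃) ≠ ⊤ ∧
      volume (polytopeH a₁ b₁ a₂ b₂ a₃ b₃) ≠ ⊤ ∧
      (volume (polytopeP2 a₁ b₁ a₂ b₂ a₃ b₃)).toReal
        = (volume (polytopeH a₁ b₁ a₂ b₂ a₃ b₃)).toReal
          + (b₁ - a₁) * (b₂ - a₂) ^ 2 * (b₃ - a₃) ^ 2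
            * (5 * (a₁ * b₁ * b₃ - a₁ * b₁ * a₃) + 3 * (b₁ ^ 2 * a₃ - a₁ ^ 2 * b₃))
            / (24 * (b₁ * b₃ - a₁ * a₃)) := by
  have h₁ : 0 < b₁ - a₁ := sub_pos.2 hb₁
  have h₂ : 0 < b₂ - a₂ := sub_pos.2 hb₂
  have h₃ : 0 < b₃ - a₃ := sub_pos.2 hb₃
  have hD : 0 < b₁ * b₃ - a₁ * a₃ := by nlinarith
  -- `ENNReal.ofReal` truncates negative numbers, so the sign of the excess is needed to recover it
  -- from the volumes. In terms of the aᵢ and bᵢ - aᵢ every term is nonnegative.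
  have hN : 0 ≤ 5 * (a₁ * b₁ * b₃ - a₁ * b₁ * a₃) + 3 * (b₁ ^ 2 * a₃ - a₁ ^ 2 * b₃) := by
    have e : 5 * (a₁ * b₁ * b₃ - a₁ * b₁ * a₃) + 3 * (b₁ ^ 2 * a₃ - a₁ ^ 2 * b₃)
        = 2 * (a₁ * (a₁ + (b₁ - a₁)) * (b₃ - a₃)) + 3 * (a₁ * (b₁ - a₁) * (b₃ - a₃))
          + 3 * (a₃ * (b₁ - a₁) * (a₁ + (b₁ - a₁) + a₁)) := by ring
    rw [e]
    positivity
  refine ⟨extremePoints_polytopeP2 ha₁ hb₁ ha₂ hb₂ ha₃ hb₃, ?_, ?_, ?_⟩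
  · rw [volume_polytopeP2 ha₁ hb₁ ha₂ hb₂ ha₃ hb₃]
    exact ENNReal.ofReal_ne_top
  · rw [volume_polytopeH ha₁ hb₁ ha₂ hb₂ ha₃ hb₃ hΩ₁ hΩ₂]
    exact ENNReal.ofReal_ne_top
  · rw [volume_polytopeP2 ha₁ hb₁ ha₂ hb₂ ha₃ hb₃, volume_polytopeH ha₁ hb₁ ha₂ hb₂ ha₃ hb₃ hΩ₁ hΩ₂,
      ENNReal.toReal_ofReal (by positivity), ENNReal.toReal_ofReal (by positivity)]
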